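/- Let $a<b$ be real numbers and let $X=(X_t:t\in\mathbb R)$ be a centered real Gaussian process with continuous sample paths on a probability space $(\Omega,\mathcal F,P)$, with covariance function $R(s,t)=E(X_sX_t)$. For a Borel probability measure $\nu$ on a compact interval put $\mathcal E(\nu)=\int\int R(s,t)\,\nu(ds)\,\nu(dt)$. Assume that (a) or (b) holds: (a) (i) $R(s,t)=\sum_{m,n\ge 0} r_{mn}s^mt^n$ for all $s,t\in\mathbb R$, for some real $(r_{mn})$, the double series converging absolutely; (ii) $\mathcal E(\nu)>0$ for every probability measure $\nu$ on any compact interval; (iii) the sample paths of $X$ are almost surely infinitely differentiable, and the covariance matrix of every finite subfamily of $(X^{(n)}_t:t\in\mathbb R,\ n=0,1,2,\dots)$ is non-singular; (iv) $\limsup_{t\to\infty}R(s,t)\le 0$ for every $s\in[a,b]$. (b) $X$ is stationary, and its spectral measure $F$ (the finite symmetric Borel measure with $R(s,t)=\int e^{i(t-s)x}F(dx)$) satisfies $\int e^{tx}F(dx)<\infty$ for all $t\in\mathbb R$ and has a support with at least one accumulation point. Let $V_*=\inf_\nu \mathcal E(\nu)$, over all Borel probability measures $\nu$ on $[a,b]$.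 Then the infimum is attained. Let $\nu_*$ be a minimizer with support $S$, let $\mu(t)=E(X_t\mid X_s=1 \text{ for all } s\in S)$, $t\in\mathbb R$ (that is, $\mu(t)=\sum_{s}a_s(t)$ when $E(X_t\mid X_s,\,s\in S)=\sum_{s}a_s(t)X_s$ almost surely, the sums running over finitely many $s\in S$, and $\mu(t)=0$ if there is no such representation; there always is one when $S$ is finite), and suppose that $\mu''(t)>0$ for all $t\in S\cap(a,b)$. Then $\nu_*$ is the unique minimizer, $S$ is finite, $V_*>0$, $P(\min_{t\in[a,b]}X_t>u)>0$ for every $u\in\mathbb R$, and, as $u\to\infty$, the conditional distribution of $u\bigl(\min_{t\in[a,b]}X_t-u\bigr)$ given $\min_{t\in[a,b]}X_t>u$ converges weakly to the exponential distribution with mean $V_*$. -/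

import Mathlib

open MeasureTheory ProbabilityTheory Filter Topology Set
open scoped BoundedContinuousFunction

noncomputable section

namespace GaussMin

variable {Ω : Type*} [MeasurableSpace Ω]

/-- A centered real Gaussian process `(X t : t ∈ ℝ)` with continuous sample paths. -/
structure IsCenteredGaussian (X : ℝ → Ω → ℝ) (P : Measure Ω) : Prop where
  measurable : ∀ t, Measurable (X t)
  gaussian : IsGaussianProcess X P
  centered : ∀ t, ∫ ω, X t ω ∂P = 0
  continuous_paths : ∀ ω, Continuous fun t => X t ω

/-- The covariance function `R(s,t) = E(X_s X_t)`. -/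
def covFun (X : ℝ → Ω → ℝ) (P : Measure Ω) (s t : ℝ) : ℝ :=
  ∫ ω, X s ω * X t ω ∂P

/-- The `n`-th derivative at time `t` of the sample path. -/
def pathDeriv (X : ℝ → Ω → ℝ) (n : ℕ) (t : ℝ) (ω : Ω) : ℝ :=
  iteratedDeriv n (fun r => X r ω) t

/-- `ν` is a Borel probability measure on the interval `[a,b]`
(seen as a measure on `ℝ` that does not charge the complement of `[a,b]`). -/
structure IsProbOn (a b : ℝ) (ν : Measure ℝ) : Prop where
  prob : IsProbabilityMeasure ν
  compl_null : ν (Icc a b)ᶜ = 0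

/-- `∫∫ R(s,t) ν(ds) ν(dt)`. -/
def energy (R : ℝ → ℝ → ℝ) (ν : Measure ℝ) : ℝ :=
  ∫ s, ∫ t, R s t ∂ν ∂ν

/-- `R` has a double power series expansion, (unconditionally) convergent on all of `ℝ × ℝ`. -/
def HasPowerExpansion (R : ℝ → ℝ → ℝ) : Prop :=
  ∃ r : ℕ → ℕ → ℝ, ∀ s t : ℝ,
    HasSum (fun p : ℕ × ℕ => r p.1 p.2 * s ^ p.1 * t ^ p.2) (R s t)

/-- Non-negative non-degeneracy on every compact interval. -/
def NonnegNondegenerate (R : ℝ → ℝ → ℝ) : Prop :=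
  ∀ c d : ℝ, c ≤ d → ∀ ν : Measure ℝ, IsProbOn c d ν → 0 < energy R ν

/-- The sample paths are (almost surely) infinitely differentiable, and the covariance matrix of
every finite subfamily of `(X_t^{(n)} : t ∈ ℝ, n ≥ 0)` is non-singular. -/
structure SmoothNonsingular (X : ℝ → Ω → ℝ) (P : Measure Ω) : Prop where
  smooth : ∀ᵐ ω ∂P, ContDiff ℝ (⊤ : ℕ∞) fun t => X t ω
  nonsingular : ∀ I : Finset (ℝ × ℕ),
    (Matrix.of fun p q : I =>
      cov[pathDeriv X p.1.2 p.1.1, pathDeriv X q.1.2 q.1.1; P]).det ≠ 0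

/-- The first set of assumptions: power expansion, non-negative non-degeneracy, smoothness and
non-singularity, and `limsup_{t → ∞} R(s,t) ≤ 0` for every `s ∈ [a,b]`. -/
structure AssumptionA (X : ℝ → Ω → ℝ) (P : Measure Ω) (a b : ℝ) : Prop where
  power : HasPowerExpansion (covFun X P)
  nondegenerate : NonnegNondegenerate (covFun X P)
  smooth : SmoothNonsingular X P
  limsup_le : ∀ s ∈ Icc a b, limsup (fun t => ((covFun X P s t : ℝ) : EReal)) atTop ≤ 0

/-- Stationarity: the finite-dimensional distributions are invariant under time shifts. -/
def IsStationary (X : ℝ → Ω → ℝ) (P : Measure Ω) : Prop :=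
  ∀ (h : ℝ) (I : Finset ℝ),
    P.map (fun ω (t : I) => X (t.1 + h) ω) = P.map (fun ω (t : I) => X t.1 ω)

/-- `F` is the spectral measure of the (stationary) process `X`: a finite symmetric Borel measure
on `ℝ` with `R(s,t) = ∫ exp(i (t - s) x) F(dx)`. -/
structure IsSpectralMeasure (X : ℝ → Ω → ℝ) (P : Measure Ω) (F : Measure ℝ) : Prop where
  finite : IsFiniteMeasure F
  symm : F.map (fun x => -x) = F
  cov_eq : ∀ s t : ℝ, ((covFun X P s t : ℝ) : ℂ) =
    ∫ x, Complex.exp (Complex.I * (((t - s) * x : ℝ) : ℂ)) ∂F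

/-- The second set of assumptions: `X` is stationary, its spectral measure has all exponential
moments, and the support of its spectral measure has an accumulation point. -/
structure AssumptionB (X : ℝ → Ω → ℝ) (P : Measure Ω) : Prop where
  stationary : IsStationary X P
  spectral : ∃ F : Measure ℝ, IsSpectralMeasure X P F ∧
    (∀ t : ℝ, Integrable (fun x => Real.exp (t * x)) F) ∧
    ∃ x : ℝ, AccPt x (𝓟 F.support)

/-- `ν` solves the problem of minimizing `∫∫ R dν dν` over the probability measures on `[a,b]`. -/
structure IsMinimizer (R : ℝ → ℝ → ℝ) (a b : ℝ) (ν : Measure ℝ) : Prop where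
  probOn : IsProbOn a b ν
  le : ∀ ν' : Measure ℝ, IsProbOn a b ν' → energy R ν ≤ energy R ν'

/-- The optimal value `V_*` of the minimization problem. -/
def optimalValue (R : ℝ → ℝ → ℝ) (a b : ℝ) : ℝ :=
  sInf (energy R '' {ν | IsProbOn a b ν})

/-- `a` gives the coefficients of a version of the conditional expectation
`E(X_t | X_s, s ∈ S) = ∑ a_s X_s` that is linear in finitely many of the `X_s`, `s ∈ S`. -/
def IsLinearRegression (X : ℝ → Ω → ℝ) (P : Measure Ω) (S : Set ℝ) (t : ℝ) (a : ℝ →₀ ℝ) :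
    Prop :=
  (a.support : Set ℝ) ⊆ S ∧
    P[X t | ⨆ s ∈ S, MeasurableSpace.comap (X s) inferInstance] =ᵐ[P]
      fun ω => a.sum fun s c => c * X s ω

open Classical in
/-- `μ(t) = E(X_t | X_s = 1 for all s ∈ S)`: the regression function
`E(X_t | X_s = x_s, s ∈ S) = ∑ a_s x_s` evaluated at `x_s = 1` for all `s ∈ S`. (For a centered
Gaussian process and a finite set `S` such that the covariance matrix of `(X_s : s ∈ S)` is
non-singular, the coefficients `a_s` exist and are unique.) -/
def condMeanOne (X : ℝ → Ω → ℝ) (P : Measure Ω) (S : Set ℝ) (t : ℝ) : ℝ :=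
  if h : ∃ a : ℝ →₀ ℝ, IsLinearRegression X P S t a then h.choose.sum fun _ c => c else 0

/-- `min_{t ∈ [a,b]} X_t`. -/
def pathMin (X : ℝ → Ω → ℝ) (a b : ℝ) (ω : Ω) : ℝ :=
  sInf ((fun t => X t ω) '' Icc a b)

/-- The event `{min_{t ∈ [a,b]} X_t > u}`. -/
def highEvent (X : ℝ → Ω → ℝ) (a b u : ℝ) : Set Ω :=
  {ω | u < pathMin X a b ω}

/-- The conditional distribution of `u (min_{t ∈ [a,b]} X_t - u)` given
`min_{t ∈ [a,b]} X_t > u`. -/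
def overshootLaw (X : ℝ → Ω → ℝ) (P : Measure Ω) (a b u : ℝ) : Measure ℝ :=
  (P[|highEvent X a b u]).map fun ω => u * (pathMin X a b ω - u)

/-- Weak convergence, as `u → ∞`, of a family of laws on `ℝ`. -/
def WeaklyConverges (law : ℝ → Measure ℝ) (limit : Measure ℝ) : Prop :=
  ∀ f : ℝ →ᵇ ℝ, Tendsto (fun u => ∫ x, f x ∂(law u)) atTop (𝓝 (∫ x, f x ∂limit))

end GaussMin

end

noncomputable section

namespace GaussMin

open scoped NNReal

/-! Let `ν` be a minimizer and `h = ∫ X_s ν(ds)`. Then `Var h = V_*`, and the first-order condition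
for the energy says `Cov(h, X_t) ≥ V_*` on `[a,b]`. So `X = h γ + Y` on `[a,b]` with `γ = Cov(h, X)
/ V_* ≥ 1`, where `Y` is independent of `h` and has zero `ν`-average. Given `Y = y`, the event `min
X > u` is `h > height γ u y`, and averaging over `ν` shows `height γ u y ≥ u`. Hence `P(min X > u)`
is the mean of a Gaussian tail at a random level of order `u`. For `‖y‖ ≤ η u` that level lies in
`[u, (1 + η) u]`, and replacing `u` by `u + s/u` raises it by an amount between `s / ((1 + η) u)`
and `s/u`. Each tail is then multiplied by about `exp(-s/V_*)`, while larger `y` are negligible by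
Fernique's theorem. This is `tendsto_exceedProb_ratio`, brought to the process by
`overshoot_weaklyConverges`. It needs only a minimizer of positive energy.

Finiteness of the support `S` is where convexity enters. The potential `t ↦ Cov(h, X_t)` is real
analytic under (a) and (b) and equals `V_*` on `S`. If `S` were infinite it would be constant on
`ℝ`. Integrating a regression identity against `ν` then makes the weights sum to one, so `μ` takes
only the values 1 and 0 and cannot have positive second derivative (`IsMinimizer.finite_support`).

For uniqueness, two minimizers have equal potentials (`IsMinimizer.potential_congr`). Under (a) both
are finitely supported and a non-singular covariance matrix identifies them; under (b) their
characteristic functions agree on the support of `F`, hence everywhere by analyticity. -/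

instance continuousMapMeasurableSpace {K : Type*} [TopologicalSpace K] :
    MeasurableSpace C(K, ℝ) := borel _

instance continuousMapBorelSpace {K : Type*} [TopologicalSpace K] : BorelSpace C(K, ℝ) := ⟨rfl⟩

/-! ### Limits of centered Gaussian variables -/

/-- A pointwise limit of centered real Gaussian variables is centered Gaussian. -/
lemma map_eq_gaussianReal_of_tendsto {Ω : Type*} [MeasurableSpace Ω] {P : Measure Ω}
    [IsProbabilityMeasure P] {Z : ℕ → Ω → ℝ} {W : Ω → ℝ} (hZ : ∀ n, Measurable (Z n))
    (hg : ∀ n, ∃ v, P.map (Z n) = gaussianReal 0 v)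
    (hlim : ∀ ω, Tendsto (fun n => Z n ω) atTop (𝓝 (W ω))) :
    ∃ v, P.map W = gaussianReal 0 v := by
  have hW : Measurable W := measurable_of_tendsto_metrizable hZ (tendsto_pi_nhds.2 hlim)
  choose v hv using hg
  have hprob : IsProbabilityMeasure (P.map W) := Measure.isProbabilityMeasure_map hW.aemeasurable
  have hφ (t : ℝ) : Tendsto (fun n => Complex.exp (((-(v n * t ^ 2 / 2) : ℝ)) : ℂ)) atTop
      (𝓝 (charFun (P.map W) t)) := by
    have h1 (n : ℕ) : Complex.exp (((-(v n * t ^ 2 / 2) : ℝ)) : ℂ) =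
        ∫ ω, Complex.exp (t * Z n ω * Complex.I) ∂P := by
      have := charFun_gaussianReal (μ := 0) (v := v n) t
      rw [← hv n, charFun_apply_real, integral_map (hZ n).aemeasurable (by fun_prop)] at this
      rw [this]; congr 1; push_cast; ring
    simp_rw [h1]
    rw [charFun_apply_real, integral_map hW.aemeasurable (by fun_prop)]
    refine tendsto_integral_of_dominated_convergence (fun _ => (1 : ℝ)) (fun n => by fun_prop)
      (integrable_const _) (fun n => ae_of_all _ fun ω => ?_) (ae_of_all _ fun ω => ?_)
    · have := Complex.norm_exp_ofReal_mul_I (t * Z n ω)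
      push_cast at this
      exact this.le
    · have : Continuous fun x : ℝ => Complex.exp (t * x * Complex.I) := by fun_prop
      exact (this.tendsto _).comp (hlim ω)
  -- At a nonzero point where the limiting characteristic function does not vanish, the logarithm of
  -- its modulus recovers the limit of the variances, which therefore cannot escape to infinity.
  obtain ⟨t₀, ht₀, hne⟩ : ∃ t₀ : ℝ, t₀ ≠ 0 ∧ charFun (P.map W) t₀ ≠ 0 := by
    have hc : ContinuousAt (charFun (P.map W)) 0 := continuous_charFun.continuousAt
    have h0 : charFun (P.map W) 0 ≠ 0 := by simp
    have h1 : ∀ᶠ t in 𝓝[≠] (0 : ℝ), charFun (P.map W) t ≠ 0 :=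
      (hc.eventually_ne h0).filter_mono nhdsWithin_le_nhds
    obtain ⟨t, ht, ht'⟩ := (h1.and self_mem_nhdsWithin).exists
    exact ⟨t, ht', ht⟩
  have hlog := ((hφ t₀).norm).log (norm_ne_zero_iff.2 hne)
  simp only [Complex.norm_exp_ofReal, Real.log_exp] at hlog
  have hvlim : Tendsto (fun n => (v n : ℝ)) atTop
      (𝓝 (-(2 / t₀ ^ 2) * Real.log ‖charFun (P.map W) t₀‖)) := by
    refine (hlog.const_mul (-(2 / t₀ ^ 2))).congr fun n => ?_
    field_simp
  set σ := -(2 / t₀ ^ 2) * Real.log ‖charFun (P.map W) t₀‖ with hσ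
  have hσ0 : 0 ≤ σ := ge_of_tendsto' hvlim fun n => (v n).2
  refine ⟨σ.toNNReal, Measure.ext_of_charFun (funext fun t => ?_)⟩
  refine tendsto_nhds_unique (hφ t) ?_
  rw [charFun_gaussianReal]
  have : Continuous fun x : ℝ => Complex.exp (((-(x * t ^ 2 / 2) : ℝ)) : ℂ) := by fun_prop
  have h2 : Complex.exp (t * (0 : ℝ) * Complex.I - ((σ.toNNReal : ℝ) : ℂ) * t ^ 2 / 2) =
      Complex.exp (((-(σ * t ^ 2 / 2) : ℝ)) : ℂ) := by
    rw [Real.coe_toNNReal _ hσ0]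
    congr 1
    push_cast
    ring
  rw [h2]
  exact (this.tendsto σ).comp hvlim

/-! ### The path as a Gaussian element of `C([a,b])` -/

section Path

variable {Ω : Type*} [MeasurableSpace Ω] {X : ℝ → Ω → ℝ} {P : Measure Ω}

/-- The restriction of the sample path to `[a,b]`. -/
def pathMap (hX : IsCenteredGaussian X P) (a b : ℝ) (ω : Ω) : C(Icc a b, ℝ) :=
  ⟨fun t => X t ω, (hX.continuous_paths ω).comp continuous_subtype_val⟩

@[simp] lemma pathMap_apply (hX : IsCenteredGaussian X P) (a b : ℝ) (ω : Ω) (t : Icc a b) :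
    pathMap hX a b ω t = X t ω := rfl

/-- Bernstein approximation of the sample path. -/
lemma exists_tendsto_pathMap (hX : IsCenteredGaussian X P) {a b : ℝ} (hab : a < b) :
    ∃ (t : ∀ n : ℕ, Fin (n + 1) → ℝ) (B : ∀ n : ℕ, Fin (n + 1) → C(Icc a b, ℝ)),
      ∀ ω, Tendsto (fun n => ∑ k, X (t n k) ω • B n k) atTop (𝓝 (pathMap hX a b ω)) := by
  let e := iccHomeoI a b hab
  refine ⟨fun n k => e.symm (bernstein.z k), fun n k => (bernstein n k).comp ⟨e, e.continuous⟩,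
    fun ω => ?_⟩
  have h1 := bernsteinApproximation_uniform ((pathMap hX a b ω).comp ⟨e.symm, e.symm.continuous⟩)
  have h2 := ((ContinuousMap.continuous_precomp
    (⟨e, e.continuous⟩ : C(Icc a b, unitInterval))).tendsto _).comp h1
  convert h2 using 2
  · ext x
    simp [bernsteinApproximation.apply, mul_comm]
  · ext x
    simp

lemma measurable_pathMap (hX : IsCenteredGaussian X P) {a b : ℝ} (hab : a < b) :
    Measurable (pathMap hX a b) := by
  obtain ⟨t, B, h⟩ := exists_tendsto_pathMap hX hab
  refine measurable_of_tendsto_metrizable (fun n => ?_) (tendsto_pi_nhds.2 h)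
  have := hX.measurable
  fun_prop

/-- A functional applied to the Bernstein approximants is a finite linear combination of values of
`X`, so Gaussianity passes from the finite-dimensional laws to the path by pointwise limits. -/
lemma map_dual_pathMap [IsProbabilityMeasure P] (hX : IsCenteredGaussian X P) {a b : ℝ}
    (hab : a < b) (L : StrongDual ℝ C(Icc a b, ℝ)) :
    ∃ v, P.map (fun ω => L (pathMap hX a b ω)) = gaussianReal 0 v := by
  obtain ⟨t, B, h⟩ := exists_tendsto_pathMap hX hab
  have hm := hX.measurable
  refine map_eq_gaussianReal_of_tendsto (Z := fun n ω => ∑ k, L (B n k) • X (t n k) ω)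
    (fun n => by fun_prop) (fun n => ?_) (fun ω => ?_)
  · have hg : HasGaussianLaw (fun ω => ∑ k, L (B n k) • X (t n k) ω) P :=
      ((hX.gaussian.comp_right (t n)).smul (fun k => L (B n k))).hasGaussianLaw_fun_sum
        (I := Finset.univ)
    have h0 : ∫ ω, ∑ k, L (B n k) • X (t n k) ω ∂P = 0 := by
      rw [integral_finsetSum]
      · simp [integral_const_mul, hX.centered]
      · intro k _
        exact ((hX.gaussian.hasGaussianLaw_eval (t n k)).integrable).const_mul (L (B n k))
    exact ⟨_, hg.map_eq_gaussianReal.trans (by rw [h0])⟩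
  · have := (L.continuous.tendsto _).comp (h ω)
    refine this.congr fun n => ?_
    simp [mul_comm]

lemma hasGaussianLaw_pathMap [IsProbabilityMeasure P] (hX : IsCenteredGaussian X P) {a b : ℝ}
    (hab : a < b) : HasGaussianLaw (pathMap hX a b) P := by
  refine ⟨isGaussian_of_map_eq_gaussianReal fun L => ?_⟩
  obtain ⟨v, hv⟩ := map_dual_pathMap hX hab L
  exact ⟨0, v, by rw [Measure.map_map (by fun_prop) (measurable_pathMap hX hab), ← hv]; rfl⟩

lemma integral_dual_pathMap [IsProbabilityMeasure P] (hX : IsCenteredGaussian X P) {a b : ℝ}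
    (hab : a < b) (L : StrongDual ℝ C(Icc a b, ℝ)) : ∫ ω, L (pathMap hX a b ω) ∂P = 0 := by
  obtain ⟨v, hv⟩ := map_dual_pathMap hX hab L
  have hm : Measurable fun ω => L (pathMap hX a b ω) :=
    L.continuous.measurable.comp (measurable_pathMap hX hab)
  have := integral_id_gaussianReal (μ := 0) (v := v)
  rwa [← hv, integral_map hm.aemeasurable (by fun_prop)] at this

end Path

/-! ### Gaussian tails under a shift of the level -/

/-- The upper tail of the centered Gaussian law of variance `v`. -/
def gaussTail (v : ℝ≥0) (z : ℝ) : ℝ := (gaussianReal 0 v).real (Ioi z)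

lemma gaussTail_nonneg (v : ℝ≥0) (z : ℝ) : 0 ≤ gaussTail v z := measureReal_nonneg

lemma gaussTail_le_one (v : ℝ≥0) (z : ℝ) : gaussTail v z ≤ 1 := measureReal_le_one

lemma gaussTail_antitone (v : ℝ≥0) : Antitone (gaussTail v) := fun _ _ h =>
  measureReal_mono (Ioi_subset_Ioi h)

lemma gaussianReal_real_eq_integral {v : ℝ≥0} (hv : v ≠ 0) (m : ℝ) (s : Set ℝ) :
    (gaussianReal m v).real s = ∫ x in s, gaussianPDFReal m v x := by
  rw [Measure.real, gaussianReal_apply_eq_integral _ hv, ENNReal.toReal_ofReal]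
  exact integral_nonneg fun x => gaussianPDFReal_nonneg _ _ x

lemma gaussTail_pos {v : ℝ≥0} (hv : v ≠ 0) (z : ℝ) : 0 < gaussTail v z := by
  rw [gaussTail, Measure.real, ENNReal.toReal_pos_iff]
  refine ⟨pos_iff_ne_zero.2 fun h => ?_, measure_lt_top _ _⟩
  have := gaussianReal_absolutelyContinuous' 0 hv h
  simp at this

/-- Translate the law instead of the level; the exponential factor is the ratio of the two Gaussian
densities. -/
lemma gaussTail_add {v : ℝ≥0} (hv : v ≠ 0) (z d : ℝ) :
    gaussTail v (z + d) =
      ∫ x in Ioi z, gaussianPDFReal 0 v x * Real.exp (-(2 * x * d + d ^ 2) / (2 * v)) := by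
  have h1 : gaussTail v (z + d) = (gaussianReal (0 - d) v).real (Ioi z) := by
    rw [← gaussianReal_map_sub_const, map_measureReal_apply (by fun_prop) measurableSet_Ioi,
      gaussTail]
    congr 1
    ext x
    simp
  rw [h1, gaussianReal_real_eq_integral hv]
  congr 1 with x
  rw [gaussianPDFReal, gaussianPDFReal, mul_assoc _ (Real.exp _) (Real.exp _), ← Real.exp_add]
  congr 2
  have : (v : ℝ) ≠ 0 := by simpa using hv
  field_simp
  ring

lemma gaussTail_eq {v : ℝ≥0} (hv : v ≠ 0) (z : ℝ) :
    gaussTail v z = ∫ x in Ioi z, gaussianPDFReal 0 v x := gaussianReal_real_eq_integral hv 0 _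

lemma gaussTail_add_le {v : ℝ≥0} (hv : v ≠ 0) {z d : ℝ} (hd : 0 ≤ d) :
    gaussTail v (z + d) ≤ Real.exp (-(z * d / v)) * gaussTail v z := by
  have hv' : (0 : ℝ) < v := by positivity
  rw [gaussTail_add hv, gaussTail_eq hv, ← integral_const_mul]
  refine integral_mono_of_nonneg ?_ ((integrable_gaussianPDFReal _ _).restrict.const_mul _) ?_
  · exact ae_of_all _ fun x => mul_nonneg (gaussianPDFReal_nonneg _ _ x) (Real.exp_pos _).le
  · filter_upwards [ae_restrict_mem measurableSet_Ioi] with x hx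
    rw [mul_comm]
    refine mul_le_mul_of_nonneg_right (Real.exp_le_exp.2 ?_) (gaussianPDFReal_nonneg _ _ x)
    rw [neg_div, neg_le_neg_iff, div_le_div_iff₀ hv' (by positivity)]
    have : z * d ≤ x * d := mul_le_mul_of_nonneg_right (le_of_lt hx) hd
    nlinarith [mul_nonneg (sq_nonneg d) hv'.le]

/-- On the window `(z, z + 1]` the density ratio is bounded below, and by `gaussTail_add_le` with `d
= 1` this window carries at least the fraction `1 - exp(-z/v)` of the tail. -/
lemma le_gaussTail_add {v : ℝ≥0} (hv : v ≠ 0) {z d : ℝ} (hd : 0 ≤ d) :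
    Real.exp (-(((z + 1) * d + d ^ 2) / v)) * (1 - Real.exp (-(z / v))) * gaussTail v z ≤
      gaussTail v (z + d) := by
  have hv' : (0 : ℝ) < v := by positivity
  have hi : Integrable (fun x => gaussianPDFReal 0 v x) := integrable_gaussianPDFReal _ _
  have h1 : gaussTail v z - gaussTail v (z + 1) = ∫ x in Ioc z (z + 1), gaussianPDFReal 0 v x := by
    have : Ioi z = Ioc z (z + 1) ∪ Ioi (z + 1) := (Ioc_union_Ioi_eq_Ioi (by linarith)).symm
    rw [gaussTail_eq hv, gaussTail_eq hv, this, setIntegral_union _ measurableSet_Ioi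
      hi.integrableOn hi.integrableOn]
    · ring
    · exact Set.disjoint_left.2 fun x hx hx' => not_lt.2 hx.2 hx'
  have h2 : (1 - Real.exp (-(z / v))) * gaussTail v z ≤ gaussTail v z - gaussTail v (z + 1) := by
    have := gaussTail_add_le hv (z := z) (d := 1) zero_le_one
    rw [mul_one] at this
    linarith
  have hint : Integrable (fun x => gaussianPDFReal 0 v x *
      Real.exp (-(2 * x * d + d ^ 2) / (2 * v))) (volume.restrict (Ioi z)) := by
    refine (hi.restrict.mul_const (Real.exp (-(z * d / v)))).mono' (by fun_prop) ?_
    filter_upwards [ae_restrict_mem measurableSet_Ioi] with x hx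
    rw [Real.norm_of_nonneg (mul_nonneg (gaussianPDFReal_nonneg _ _ x) (Real.exp_pos _).le)]
    refine mul_le_mul_of_nonneg_left (Real.exp_le_exp.2 ?_) (gaussianPDFReal_nonneg _ _ x)
    rw [neg_div, neg_le_neg_iff, div_le_div_iff₀ hv' (by positivity)]
    have : z * d ≤ x * d := mul_le_mul_of_nonneg_right (le_of_lt hx) hd
    nlinarith [mul_nonneg (sq_nonneg d) hv'.le]
  calc Real.exp (-(((z + 1) * d + d ^ 2) / v)) * (1 - Real.exp (-(z / v))) * gaussTail v z
      ≤ Real.exp (-(((z + 1) * d + d ^ 2) / v)) * ∫ x in Ioc z (z + 1), gaussianPDFReal 0 v x := by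
        rw [mul_assoc, ← h1]
        exact mul_le_mul_of_nonneg_left h2 (Real.exp_pos _).le
    _ = ∫ x in Ioc z (z + 1), gaussianPDFReal 0 v x * Real.exp (-(((z + 1) * d + d ^ 2) / v)) := by
        rw [integral_mul_const, mul_comm]
    _ ≤ ∫ x in Ioc z (z + 1), gaussianPDFReal 0 v x *
          Real.exp (-(2 * x * d + d ^ 2) / (2 * v)) := by
        refine setIntegral_mono_on (hi.integrableOn.mul_const _)
          (hint.mono_measure (Measure.restrict_mono Ioc_subset_Ioi_self le_rfl)) measurableSet_Ioc ?_
        intro x hx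
        refine mul_le_mul_of_nonneg_left (Real.exp_le_exp.2 ?_) (gaussianPDFReal_nonneg _ _ x)
        rw [neg_div, neg_le_neg_iff, div_le_div_iff₀ (by positivity) hv']
        have : x * d ≤ (z + 1) * d := mul_le_mul_of_nonneg_right hx.2 hd
        nlinarith [mul_nonneg (sq_nonneg d) hv'.le]
    _ ≤ gaussTail v (z + d) := by
        rw [gaussTail_add hv]
        refine setIntegral_mono_set hint ?_ Ioc_subset_Ioi_self.eventuallyLE
        exact ae_of_all _ fun x => mul_nonneg (gaussianPDFReal_nonneg _ _ x) (Real.exp_pos _).le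

/-! ### The random level to be exceeded -/

section Height

variable {K : Type*} [TopologicalSpace K] [CompactSpace K] [Nonempty K]

/-- The least level `z` such that `γ * z + y ≥ u`. -/
def height (γ : C(K, ℝ)) (u : ℝ) (y : C(K, ℝ)) : ℝ := ⨆ x, (u - y x) / γ x

variable {γ : C(K, ℝ)} (hγ : ∀ x, 1 ≤ γ x)

include hγ

lemma exists_height_eq (u : ℝ) (y : C(K, ℝ)) :
    ∃ x₀, height γ u y = (u - y x₀) / γ x₀ ∧ ∀ x, (u - y x) / γ x ≤ height γ u y := by
  have hc : Continuous fun x => (u - y x) / γ x :=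
    (continuous_const.sub y.continuous).div γ.continuous fun x => by linarith [hγ x]
  obtain ⟨x₀, -, hx₀⟩ := isCompact_univ.exists_isMaxOn univ_nonempty hc.continuousOn
  have hle : ∀ x, (u - y x) / γ x ≤ (u - y x₀) / γ x₀ := fun x => hx₀ (mem_univ x)
  have : height γ u y = (u - y x₀) / γ x₀ :=
    le_antisymm (ciSup_le hle) (le_ciSup (f := fun x => (u - y x) / γ x)
      ⟨_, by rintro _ ⟨x, rfl⟩; exact hle x⟩ x₀)
  exact ⟨x₀, this, fun x => this ▸ hle x⟩

lemma setOf_forall_lt_eq_Ioi (u : ℝ) (y : C(K, ℝ)) :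
    {z : ℝ | ∀ x, u < γ x * z + y x} = Ioi (height γ u y) := by
  obtain ⟨x₀, h0, hle⟩ := exists_height_eq hγ u y
  ext z
  have key (x : K) : u < γ x * z + y x ↔ (u - y x) / γ x < z := by
    rw [div_lt_iff₀ (by linarith [hγ x])]
    constructor <;> intro h <;> linarith [mul_comm z (γ x)]
  simp only [Set.mem_ofPred_eq, mem_Ioi, key]
  exact ⟨fun h => h0 ▸ h x₀, fun h x => (hle x).trans_lt h⟩

lemma height_lipschitz (u : ℝ) : LipschitzWith 1 (height γ u) := by
  refine LipschitzWith.of_le_add fun y y' => ?_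
  obtain ⟨x₀, h0, -⟩ := exists_height_eq hγ u y
  obtain ⟨-, -, hle⟩ := exists_height_eq hγ u y'
  have hpos : 0 < γ x₀ := by linarith [hγ x₀]
  have hd : dist (y x₀) (y' x₀) ≤ dist y y' := ContinuousMap.dist_apply_le_dist x₀
  rw [Real.dist_eq] at hd
  have h1 := (abs_le.1 hd).1
  refine (h0.trans_le ?_).trans (add_le_add_left (hle x₀) _)
  rw [div_add' _ _ _ hpos.ne', div_le_div_iff_of_pos_right hpos]
  nlinarith [hγ x₀, dist_nonneg (x := y) (y := y')]

lemma height_add_le {d : ℝ} (hd : 0 ≤ d) (u : ℝ) (y : C(K, ℝ)) :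
    height γ (u + d) y ≤ height γ u y + d := by
  obtain ⟨x₀, h0, -⟩ := exists_height_eq hγ (u + d) y
  obtain ⟨-, -, hle⟩ := exists_height_eq hγ u y
  have hpos : 0 < γ x₀ := by linarith [hγ x₀]
  refine (h0.trans_le ?_).trans (add_le_add_left (hle x₀) _)
  rw [div_add' _ _ _ hpos.ne', div_le_div_iff_of_pos_right hpos]
  nlinarith [hγ x₀]

lemma height_le {u : ℝ} (hu : 0 ≤ u) (y : C(K, ℝ)) : height γ u y ≤ u + ‖y‖ := by
  obtain ⟨x₀, h0, -⟩ := exists_height_eq hγ u y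
  have hpos : 0 < γ x₀ := by linarith [hγ x₀]
  rw [h0, div_le_iff₀ hpos]
  have := (abs_le.1 (y.norm_coe_le_norm x₀)).1
  nlinarith [hγ x₀, norm_nonneg y]

/-- At the point `x₀` attaining the level, `u ≤ (u - y x₀) / γ x₀` forces `γ x₀ ≤ 1 + η`. Raising
`u` by `d` therefore gains at least `d / (1 + η)` already at `x₀`. -/
lemma le_height_add {η u d : ℝ} (hu : 0 < u) (hd : 0 ≤ d) {y : C(K, ℝ)}
    (hy : ‖y‖ ≤ η * u) (hh : u ≤ height γ u y) :
    height γ u y + d / (1 + η) ≤ height γ (u + d) y := by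
  obtain ⟨x₀, h0, -⟩ := exists_height_eq hγ u y
  obtain ⟨-, -, hle⟩ := exists_height_eq hγ (u + d) y
  have hpos : 0 < γ x₀ := by linarith [hγ x₀]
  have h1 : γ x₀ ≤ 1 + η := by
    rw [h0, le_div_iff₀ hpos] at hh
    have := (abs_le.1 (y.norm_coe_le_norm x₀)).1
    have h2 : u * γ x₀ ≤ u * (1 + η) := by linarith
    exact le_of_mul_le_mul_left h2 hu
  have h2 : d / (1 + η) ≤ d / γ x₀ := div_le_div_of_nonneg_left hd hpos h1
  calc height γ u y + d / (1 + η) ≤ (u - y x₀) / γ x₀ + d / γ x₀ := by rw [h0]; gcongr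
    _ = (u + d - y x₀) / γ x₀ := by rw [← add_div]; ring
    _ ≤ _ := hle x₀

end Height

/-! ### Asymptotic ratio of exceedance probabilities -/

section Ratio

variable {K : Type*} [TopologicalSpace K] [CompactSpace K] [Nonempty K]

/-- Probability that `γ * h + Y > u` everywhere, for `h` centered Gaussian of variance `v`,
independent of `Y` with law `ρ`. -/
def exceedProb (γ : C(K, ℝ)) (v : ℝ≥0) (ρ : Measure C(K, ℝ)) (u : ℝ) : ℝ :=
  ∫ y, gaussTail v (height γ u y) ∂ρ

variable {γ : C(K, ℝ)} (hγ : ∀ x, 1 ≤ γ x) {v : ℝ≥0} (hv : v ≠ 0)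
  {ρ : Measure C(K, ℝ)} [IsProbabilityMeasure ρ]

include hγ

lemma integrable_gaussTail_height (u : ℝ) :
    Integrable (fun y => gaussTail v (height γ u y)) ρ := by
  have hm : Measurable fun y => gaussTail v (height γ u y) :=
    (gaussTail_antitone v).measurable.comp (height_lipschitz hγ u).continuous.measurable
  refine (integrable_const (1 : ℝ)).mono' hm.aestronglyMeasurable (ae_of_all _ fun y => ?_)
  rw [Real.norm_of_nonneg (gaussTail_nonneg _ _)]
  exact gaussTail_le_one _ _

lemma mul_gaussTail_le_exceedProb {u M : ℝ} (hu : 0 ≤ u) :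
    ρ.real {y | ‖y‖ ≤ M} * gaussTail v (u + M) ≤ exceedProb γ v ρ u := by
  have hms : MeasurableSet {y : C(K, ℝ) | ‖y‖ ≤ M} := measurableSet_le (by fun_prop) (by fun_prop)
  have : ρ.real {y | ‖y‖ ≤ M} * gaussTail v (u + M) =
      ∫ y, {y : C(K, ℝ) | ‖y‖ ≤ M}.indicator (fun _ => gaussTail v (u + M)) y ∂ρ := by
    rw [integral_indicator hms, setIntegral_const, smul_eq_mul]
  rw [this]
  refine integral_mono ((integrable_const _).indicator hms) (integrable_gaussTail_height hγ u)
    fun y => ?_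
  by_cases hy : y ∈ {y : C(K, ℝ) | ‖y‖ ≤ M}
  · simp only [Set.indicator_of_mem hy]
    exact gaussTail_antitone v ((height_le hγ hu y).trans (by gcongr; exact hy))
  · simp only [Set.indicator_of_notMem hy]
    exact gaussTail_nonneg _ _

include hv

/-- For `‖y‖ ≤ η u` the level is at least `u` and rises by at least `s / (u (1 + η))`, which yields
the exponential factor. For the remaining `y` the tail is at most `gaussTail v u`. -/
lemma exceedProb_add_le (hρ : ∀ᵐ y ∂ρ, ∀ u, u ≤ height γ u y) {η s u : ℝ} (hη : 0 ≤ η)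
    (hs : 0 ≤ s) (hu : 0 < u) :
    exceedProb γ v ρ (u + s / u) ≤ Real.exp (-(s / (1 + η) / v)) * exceedProb γ v ρ u +
      gaussTail v u * ρ.real {y | η * u < ‖y‖} := by
  have hms : MeasurableSet {y : C(K, ℝ) | η * u < ‖y‖} :=
    measurableSet_lt (by fun_prop) (by fun_prop)
  have hi := integrable_gaussTail_height (v := v) (ρ := ρ) hγ u
  have hi2 : Integrable ({y : C(K, ℝ) | η * u < ‖y‖}.indicator fun _ => gaussTail v u) ρ :=
    (integrable_const _).indicator hms
  have : gaussTail v u * ρ.real {y | η * u < ‖y‖} =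
      ∫ y, {y : C(K, ℝ) | η * u < ‖y‖}.indicator (fun _ => gaussTail v u) y ∂ρ := by
    rw [integral_indicator hms, setIntegral_const, smul_eq_mul, mul_comm]
  rw [this, exceedProb, exceedProb, ← integral_const_mul, ← integral_add (hi.const_mul _) hi2]
  refine integral_mono_ae (integrable_gaussTail_height hγ _) ((hi.const_mul _).add hi2) ?_
  filter_upwards [hρ] with y hy
  have hsu : 0 ≤ s / u := by positivity
  by_cases hyn : y ∈ {y : C(K, ℝ) | η * u < ‖y‖}
  · simp only [Set.indicator_of_mem hyn]
    have h1 : gaussTail v (height γ (u + s / u) y) ≤ gaussTail v u :=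
      gaussTail_antitone v (le_trans (by linarith) (hy (u + s / u)))
    have h2 := mul_nonneg (Real.exp_pos (-(s / (1 + η) / v))).le
      (gaussTail_nonneg v (height γ u y))
    linarith
  · simp only [Set.indicator_of_notMem hyn, add_zero]
    have hy' : ‖y‖ ≤ η * u := not_lt.1 hyn
    have h1 := le_height_add hγ hu hsu hy' (hy u)
    refine ((gaussTail_antitone v h1).trans (gaussTail_add_le hv (by positivity))).trans ?_
    refine mul_le_mul_of_nonneg_right (Real.exp_le_exp.2 ?_) (gaussTail_nonneg _ _)
    rw [neg_le_neg_iff]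
    refine div_le_div_of_nonneg_right ?_ v.2
    have h2 : s / (1 + η) = u * (s / u / (1 + η)) := by field_simp
    rw [h2]
    exact mul_le_mul_of_nonneg_right (hy u) (by positivity)

/-- Reverse comparison: for `‖y‖ ≤ η u` the level is at most `(1 + η) u` and rises by at most `s /
u`; for other `y` the error term dominates the left side. -/
lemma mul_exceedProb_le (hρ : ∀ᵐ y ∂ρ, ∀ u, u ≤ height γ u y) {η s u : ℝ} (hη : 0 ≤ η)
    (hs : 0 ≤ s) (hu : 0 < u) :
    Real.exp (-((((1 + η) * u + 1) * (s / u) + (s / u) ^ 2) / v)) * (1 - Real.exp (-(u / v))) *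
      exceedProb γ v ρ u ≤ exceedProb γ v ρ (u + s / u) +
      gaussTail v u * ρ.real {y | η * u < ‖y‖} := by
  have hms : MeasurableSet {y : C(K, ℝ) | η * u < ‖y‖} :=
    measurableSet_lt (by fun_prop) (by fun_prop)
  have hi := integrable_gaussTail_height (v := v) (ρ := ρ) hγ u
  have hi' := integrable_gaussTail_height (v := v) (ρ := ρ) hγ (u + s / u)
  have hi2 : Integrable ({y : C(K, ℝ) | η * u < ‖y‖}.indicator fun _ => gaussTail v u) ρ :=
    (integrable_const _).indicator hms
  have : gaussTail v u * ρ.real {y | η * u < ‖y‖} =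
      ∫ y, {y : C(K, ℝ) | η * u < ‖y‖}.indicator (fun _ => gaussTail v u) y ∂ρ := by
    rw [integral_indicator hms, setIntegral_const, smul_eq_mul, mul_comm]
  rw [this, exceedProb, exceedProb, ← integral_const_mul, ← integral_add hi' hi2]
  refine integral_mono_ae (hi.const_mul _) (hi'.add hi2) ?_
  filter_upwards [hρ] with y hy
  have hsu : 0 ≤ s / u := by positivity
  have hv' : (0 : ℝ) < v := by positivity
  have hexp {z : ℝ} (hz : 0 ≤ z) : Real.exp (-z) ≤ 1 := Real.exp_le_one_iff.2 (by linarith)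
  by_cases hyn : y ∈ {y : C(K, ℝ) | η * u < ‖y‖}
  · simp only [Set.indicator_of_mem hyn]
    have h1 : gaussTail v (height γ u y) ≤ gaussTail v u := gaussTail_antitone v (hy u)
    have h2 := gaussTail_nonneg v (height γ (u + s / u) y)
    have h3 : Real.exp (-((((1 + η) * u + 1) * (s / u) + (s / u) ^ 2) / v)) *
        (1 - Real.exp (-(u / v))) ≤ 1 := by
      refine mul_le_one₀ (hexp (by positivity)) ?_ (by linarith [Real.exp_pos (-(u / v))])
      linarith [hexp (z := u / v) (by positivity)]
    nlinarith [gaussTail_nonneg v (height γ u y)]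
  · simp only [Set.indicator_of_notMem hyn, add_zero]
    have hy' : ‖y‖ ≤ η * u := not_lt.1 hyn
    refine le_trans ?_ (gaussTail_antitone v (height_add_le hγ hsu u y))
    refine le_trans ?_ (le_gaussTail_add hv hsu)
    have h1 : height γ u y ≤ (1 + η) * u := (height_le hγ hu.le y).trans (by linarith)
    have h2 := hy u
    have h4 : 0 ≤ 1 - Real.exp (-(u / v)) := by
      linarith [hexp (z := u / v) (by positivity)]
    gcongr
    exact gaussTail_nonneg _ _

lemma exceedProb_pos {B : ℝ} (hB : 0 < ρ.real {y | ‖y‖ ≤ B}) {u : ℝ} (hu : 0 ≤ u) :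
    0 < exceedProb γ v ρ u :=
  (mul_pos hB (gaussTail_pos hv _)).trans_le (mul_gaussTail_le_exceedProb hγ hu)

-- Exponential Markov inequality for the square of the norm.
omit [Nonempty K] hγ hv in
lemma measureReal_norm_gt_le {C : ℝ} (hC : 0 < C)
    (hint : Integrable (fun y : C(K, ℝ) => Real.exp (C * ‖y‖ ^ 2)) ρ) {r : ℝ} (hr : 0 ≤ r) :
    ρ.real {y | r < ‖y‖} ≤ (∫ y, Real.exp (C * ‖y‖ ^ 2) ∂ρ) * Real.exp (-(C * r ^ 2)) := by
  have h1 : ρ.real {y | r < ‖y‖} ≤ ρ.real {y | Real.exp (C * r ^ 2) ≤ Real.exp (C * ‖y‖ ^ 2)} := by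
    refine measureReal_mono fun y hy => Real.exp_le_exp.2 ?_
    have : r < ‖y‖ := hy
    gcongr
  have h2 := mul_meas_ge_le_integral_of_nonneg (ae_of_all _ fun y => (Real.exp_pos _).le) hint
    (Real.exp (C * r ^ 2))
  rw [Real.exp_neg, ← div_eq_mul_inv, le_div_iff₀ (Real.exp_pos _), mul_comm]
  exact (mul_le_mul_of_nonneg_left h1 (Real.exp_pos _).le).trans h2

omit [Nonempty K] hγ hv in
lemma exists_half_le_measureReal_norm_le {C : ℝ} (hC : 0 < C)
    (hint : Integrable (fun y : C(K, ℝ) => Real.exp (C * ‖y‖ ^ 2)) ρ) :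
    ∃ M, 0 ≤ M ∧ 1 / 2 ≤ ρ.real {y | ‖y‖ ≤ M} := by
  have hlim : Tendsto (fun M : ℝ => (∫ y, Real.exp (C * ‖y‖ ^ 2) ∂ρ) * Real.exp (-(C * M ^ 2)))
      atTop (𝓝 ((∫ y, Real.exp (C * ‖y‖ ^ 2) ∂ρ) * 0)) := by
    refine (Real.tendsto_exp_neg_atTop_nhds_zero.comp ?_).const_mul _
    exact (tendsto_pow_atTop two_ne_zero).const_mul_atTop hC
  rw [mul_zero] at hlim
  obtain ⟨M, hM, hM0⟩ := ((hlim.eventually_le_const (show (0 : ℝ) < 1 / 2 by norm_num)).and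
    (eventually_ge_atTop 0)).exists
  refine ⟨M, hM0, ?_⟩
  have h1 := (measureReal_norm_gt_le hC hint hM0).trans hM
  have h2 : {y : C(K, ℝ) | ‖y‖ ≤ M}ᶜ = {y | M < ‖y‖} := by ext; simp
  have h3 := probReal_compl_eq_one_sub (μ := ρ) (s := {y : C(K, ℝ) | ‖y‖ ≤ M})
    (measurableSet_le (by fun_prop) (by fun_prop))
  rw [h2] at h3
  linarith

/-- The contribution of large `Y` to the exceedance probability is negligible. -/
lemma tendsto_negligible {C : ℝ} (hC : 0 < C)
    (hint : Integrable (fun y : C(K, ℝ) => Real.exp (C * ‖y‖ ^ 2)) ρ) {η : ℝ} (hη : 0 < η) :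
    Tendsto (fun u => gaussTail v u * ρ.real {y | η * u < ‖y‖} / exceedProb γ v ρ u) atTop
      (𝓝 0) := by
  obtain ⟨M, hM0, hM⟩ := exists_half_le_measureReal_norm_le hC hint
  have hv' : (0 : ℝ) < v := by positivity
  set B := ∫ y, Real.exp (C * ‖y‖ ^ 2) ∂ρ
  have hB : 0 ≤ B := integral_nonneg fun y => (Real.exp_pos _).le
  have hden : Tendsto (fun u : ℝ => 1 - Real.exp (-(u / v))) atTop (𝓝 1) := by
    have : Tendsto (fun u : ℝ => Real.exp (-(u / v))) atTop (𝓝 0) :=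
      Real.tendsto_exp_neg_atTop_nhds_zero.comp (tendsto_id.atTop_div_const hv')
    simpa using this.const_sub 1
  -- The quadratic decay from the Fernique bound beats the loss in comparing `gaussTail v u` with
  -- `gaussTail v (u + M)`, whose exponent is only linear in `u`.
  have hexp : Tendsto (fun u : ℝ => Real.exp (-(C * (η * u) ^ 2) + ((u + 1) * M + M ^ 2) / v))
      atTop (𝓝 0) := by
    refine Real.tendsto_exp_atBot.comp ?_
    have h1 : Tendsto (fun u : ℝ => u * (C * η ^ 2 * u + -(M / v)) + -((M + M ^ 2) / v))
        atTop atTop := by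
      refine tendsto_atTop_add_const_right _ _ (tendsto_id.atTop_mul_atTop₀ ?_)
      exact tendsto_atTop_add_const_right _ _ (tendsto_id.const_mul_atTop (by positivity))
    refine (tendsto_neg_atTop_atBot.comp h1).congr fun u => ?_
    simp only [Function.comp]
    field_simp
    ring
  have hlim := ((hexp.const_mul (2 * B)).div hden one_ne_zero)
  rw [mul_zero, zero_div] at hlim
  refine tendsto_of_tendsto_of_tendsto_of_le_of_le' tendsto_const_nhds hlim ?_ ?_
  · filter_upwards [eventually_ge_atTop 0] with u hu
    have := exceedProb_pos (u := u) hγ hv (hM.trans_lt' (by norm_num)) hu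
    exact div_nonneg (mul_nonneg (gaussTail_nonneg _ _) measureReal_nonneg) this.le
  · filter_upwards [eventually_gt_atTop 0] with u hu
    have hp := exceedProb_pos (u := u) hγ hv (hM.trans_lt' (by norm_num)) hu.le
    have hd : 0 < 1 - Real.exp (-(u / v)) := by
      have : Real.exp (-(u / v)) < 1 := Real.exp_lt_one_iff.2 (by simp; positivity)
      linarith
    have h1 := mul_gaussTail_le_exceedProb (ρ := ρ) (M := M) (v := v) hγ hu.le
    have h2 := le_gaussTail_add hv (z := u) hM0
    have h3 := measureReal_norm_gt_le hC hint (r := η * u) (by positivity)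
    have hT := gaussTail_nonneg v u
    simp only [Pi.div_apply]
    rw [div_le_div_iff₀ hp hd, Real.exp_add]
    set E := Real.exp (((u + 1) * M + M ^ 2) / v) with hE
    have hEpos : 0 < E := Real.exp_pos _
    have h4 : (1 - Real.exp (-(u / v))) * gaussTail v u ≤ E * gaussTail v (u + M) := by
      rw [Real.exp_neg, ← hE] at h2
      have := mul_le_mul_of_nonneg_left h2 hEpos.le
      rwa [← mul_assoc, ← mul_assoc, mul_inv_cancel₀ hEpos.ne', one_mul] at this
    have h5 : gaussTail v (u + M) ≤ 2 * exceedProb γ v ρ u := by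
      nlinarith [gaussTail_nonneg v (u + M)]
    have h6 : (1 - Real.exp (-(u / v))) * gaussTail v u ≤ E * (2 * exceedProb γ v ρ u) :=
      h4.trans (by gcongr)
    calc gaussTail v u * ρ.real {y | η * u < ‖y‖} * (1 - Real.exp (-(u / v)))
        = ((1 - Real.exp (-(u / v))) * gaussTail v u) * ρ.real {y | η * u < ‖y‖} := by ring
      _ ≤ (E * (2 * exceedProb γ v ρ u)) * (B * Real.exp (-(C * (η * u) ^ 2))) := by
        gcongr
      _ = _ := by ring

/-- The two comparisons are used with `η` fixed as `u → ∞`, where the error is negligible; `η` is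
chosen beforehand so small that the resulting bound is on the right side of `c`. -/
theorem tendsto_exceedProb_ratio (hρ : ∀ᵐ y ∂ρ, ∀ u, u ≤ height γ u y) {C : ℝ} (hC : 0 < C)
    (hint : Integrable (fun y : C(K, ℝ) => Real.exp (C * ‖y‖ ^ 2)) ρ) {s : ℝ} (hs : 0 ≤ s) :
    Tendsto (fun u => exceedProb γ v ρ (u + s / u) / exceedProb γ v ρ u) atTop
      (𝓝 (Real.exp (-(s / v)))) := by
  obtain ⟨M, hM0, hM⟩ := exists_half_le_measureReal_norm_le hC hint
  have hv' : (0 : ℝ) < v := by positivity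
  have hpos {u : ℝ} (hu : 0 < u) : 0 < exceedProb γ v ρ u :=
    exceedProb_pos hγ hv (hM.trans_lt' (by norm_num)) hu.le
  refine tendsto_order.2 ⟨fun c hc => ?_, fun c hc => ?_⟩
  · obtain ⟨η, hηc, hη⟩ : ∃ η : ℝ, c < Real.exp (-((1 + η) * s / v)) ∧ 0 < η := by
      have : Tendsto (fun η : ℝ => Real.exp (-((1 + η) * s / v))) (𝓝[>] 0)
          (𝓝 (Real.exp (-((1 + 0) * s / v)))) :=
        Continuous.tendsto (by fun_prop) 0 |>.mono_left nhdsWithin_le_nhds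
      rw [add_zero, one_mul] at this
      exact ((this.eventually_const_lt hc).and self_mem_nhdsWithin).exists
    have h1 : Tendsto (fun u : ℝ =>
        Real.exp (-((((1 + η) * u + 1) * (s / u) + (s / u) ^ 2) / v)) * (1 - Real.exp (-(u / v))) -
        gaussTail v u * ρ.real {y | η * u < ‖y‖} / exceedProb γ v ρ u) atTop
        (𝓝 (Real.exp (-((1 + η) * s / v)) * (1 - 0) - 0)) := by
      refine Tendsto.sub (Tendsto.mul ?_ (Tendsto.const_sub 1 ?_))
        (tendsto_negligible hγ hv hC hint hη)
      · refine (Real.continuous_exp.tendsto _).comp (Tendsto.neg (Tendsto.div_const ?_ _))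
        have hsu : Tendsto (fun u : ℝ => s / u) atTop (𝓝 0) := tendsto_id.const_div_atTop s
        have h2 : Tendsto (fun u : ℝ => (1 + η) * s + s / u + (s / u) ^ 2) atTop
            (𝓝 ((1 + η) * s + 0 + 0 ^ 2)) := (hsu.const_add _).add (hsu.pow 2)
        rw [add_zero, zero_pow two_ne_zero, add_zero] at h2
        refine h2.congr' ?_
        filter_upwards [eventually_gt_atTop 0] with u hu
        field_simp
      · exact Real.tendsto_exp_neg_atTop_nhds_zero.comp (tendsto_id.atTop_div_const hv')
    rw [sub_zero, sub_zero, mul_one] at h1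
    filter_upwards [h1.eventually_const_lt hηc, eventually_gt_atTop 0] with u hu hu0
    refine hu.trans_le ?_
    have h2 := mul_exceedProb_le hγ hv hρ hη.le hs hu0
    rw [le_div_iff₀ (hpos hu0), sub_mul, div_mul_cancel₀ _ (hpos hu0).ne']
    linarith
  · obtain ⟨η, hηc, hη⟩ : ∃ η : ℝ, Real.exp (-(s / (1 + η) / v)) < c ∧ 0 < η := by
      have : Tendsto (fun η : ℝ => Real.exp (-(s / (1 + η) / v))) (𝓝[>] 0)
          (𝓝 (Real.exp (-(s / (1 + 0) / v)))) := by
        refine Tendsto.mono_left ?_ nhdsWithin_le_nhds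
        refine ContinuousAt.tendsto (f := fun η : ℝ => Real.exp (-(s / (1 + η) / v))) ?_
        fun_prop (disch := norm_num)
      rw [add_zero, div_one] at this
      exact ((this.eventually_lt_const hc).and self_mem_nhdsWithin).exists
    have h1 := (tendsto_negligible hγ hv hC hint hη).const_add (Real.exp (-(s / (1 + η) / v)))
    rw [add_zero] at h1
    filter_upwards [h1.eventually_lt_const hηc, eventually_gt_atTop 0] with u hu hu0
    refine lt_of_le_of_lt ?_ hu
    have h2 := exceedProb_add_le hγ hv hρ hη.le hs hu0
    rw [div_le_iff₀ (hpos hu0), add_mul, div_mul_cancel₀ _ (hpos hu0).ne']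
    exact h2

end Ratio

/-! ### Averages against a probability measure -/

section Average

variable {K : Type*} [TopologicalSpace K] [CompactSpace K] [MeasurableSpace K] [BorelSpace K]

lemma integrable_continuousMap (ν : Measure K) [IsFiniteMeasure ν] (f : C(K, ℝ)) :
    Integrable f ν :=
  f.continuous.integrable_of_hasCompactSupport
    (HasCompactSupport.of_compactSpace _)

/-- Integration against a probability measure, as a continuous linear form. -/
def avg (ν : Measure K) [IsProbabilityMeasure ν] : C(K, ℝ) →L[ℝ] ℝ :=
  LinearMap.mkContinuous
    { toFun := fun f => ∫ x, f x ∂ν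
      map_add' := fun f g =>
        integral_add (integrable_continuousMap ν f) (integrable_continuousMap ν g)
      map_smul' := fun c f => integral_const_mul c _ } 1 fun f => by
    rw [one_mul]
    exact (norm_integral_le_of_norm_le_const (ae_of_all _ f.norm_coe_le_norm)).trans (by simp)

lemma avg_apply (ν : Measure K) [IsProbabilityMeasure ν] (f : C(K, ℝ)) :
    avg ν f = ∫ x, f x ∂ν := rfl

lemma abs_avg_le (ν : Measure K) [IsProbabilityMeasure ν] (f : C(K, ℝ)) : |avg ν f| ≤ ‖f‖ :=
  (norm_integral_le_of_norm_le_const (ae_of_all _ f.norm_coe_le_norm)).trans (by simp)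

/-- Integrate the pointwise inequality `u ≤ height γ u y * γ x + y x` against `ν`. -/
lemma le_height_of_avg_eq_zero [Nonempty K] {ν : Measure K} [IsProbabilityMeasure ν]
    {γ y : C(K, ℝ)} (hγ : ∀ x, 1 ≤ γ x) (hγν : avg ν γ = 1) (hy : avg ν y = 0) (u : ℝ) :
    u ≤ height γ u y := by
  obtain ⟨-, -, hle⟩ := exists_height_eq hγ u y
  have h1 : ∀ x, u ≤ height γ u y * γ x + y x := fun x => by
    have := hle x
    rw [div_le_iff₀ (by linarith [hγ x])] at this
    linarith
  have h2 : ∫ _, u ∂ν ≤ ∫ x, (height γ u y * γ x + y x) ∂ν :=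
    integral_mono (integrable_const _) (((integrable_continuousMap ν γ).const_mul _).add
      (integrable_continuousMap ν y)) h1
  rw [integral_add ((integrable_continuousMap ν γ).const_mul _) (integrable_continuousMap ν y),
    integral_const_mul, ← avg_apply, ← avg_apply, hγν, hy] at h2
  simpa using h2

end Average

/-! ### Independent decomposition of the path -/

section Decomposition

variable {Ω : Type*} [MeasurableSpace Ω] {X : ℝ → Ω → ℝ} {P : Measure Ω} [IsProbabilityMeasure P]
  (hX : IsCenteredGaussian X P) {a b : ℝ} (hab : a < b)

include hab

lemma integrable_norm_pathMap_sq : Integrable (fun ω => ‖pathMap hX a b ω‖ ^ 2) P :=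
  (hasGaussianLaw_pathMap hX hab).memLp_two.integrable_norm_pow two_ne_zero

variable (ν : Measure (Icc a b)) [IsProbabilityMeasure ν]

lemma integrable_avg_smul_pathMap :
    Integrable (fun ω => avg ν (pathMap hX a b ω) • pathMap hX a b ω) P := by
  have hm := measurable_pathMap hX hab
  refine (integrable_norm_pathMap_sq hX hab).mono'
    (((avg ν).continuous.measurable.comp hm).smul hm).aestronglyMeasurable (ae_of_all _ fun ω => ?_)
  rw [norm_smul, sq]
  exact mul_le_mul_of_nonneg_right (abs_avg_le ν _) (norm_nonneg _)

/-- The covariances of the path with its average over `ν`. -/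
def avgCov (a b : ℝ) (ν : Measure (Icc a b)) [IsProbabilityMeasure ν] : C(Icc a b, ℝ) :=
  ∫ ω, avg ν (pathMap hX a b ω) • pathMap hX a b ω ∂P

lemma dual_avgCov (L : StrongDual ℝ C(Icc a b, ℝ)) :
    L (avgCov hX a b ν) = ∫ ω, avg ν (pathMap hX a b ω) * L (pathMap hX a b ω) ∂P := by
  rw [avgCov, ← L.integral_comp_comm (integrable_avg_smul_pathMap hX hab ν)]
  simp

lemma avgCov_apply (x : Icc a b) :
    avgCov hX a b ν x = ∫ ω, avg ν (pathMap hX a b ω) * X x ω ∂P := by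
  have := dual_avgCov hX hab ν (ContinuousMap.evalCLM ℝ x)
  simpa using this

/-- The linear map sending a path to its average and the residual. -/
def splitMap (γ : C(Icc a b, ℝ)) : C(Icc a b, ℝ) →L[ℝ] ℝ × C(Icc a b, ℝ) :=
  (avg ν).prod (ContinuousLinearMap.id ℝ _ - (avg ν).smulRight γ)

omit hab in
lemma splitMap_apply (γ f : C(Icc a b, ℝ)) : splitMap ν γ f = (avg ν f, f - avg ν f • γ) := rfl

variable {V : ℝ} (hV : 0 < V) (hVavg : ∫ ω, avg ν (pathMap hX a b ω) ^ 2 ∂P = V)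

include hV hVavg

lemma avg_avgCov : avg ν (V⁻¹ • avgCov hX a b ν) = 1 := by
  rw [map_smul, dual_avgCov hX hab ν (avg ν)]
  simp_rw [← sq]
  rw [hVavg, smul_eq_mul, inv_mul_cancel₀ hV.ne']

/-- The average and the residual are jointly Gaussian, and `γ` is the regression coefficient that
makes them uncorrelated, hence independent. -/
lemma map_splitMap : P.map (fun ω => splitMap ν (V⁻¹ • avgCov hX a b ν) (pathMap hX a b ω)) =
    (gaussianReal 0 V.toNNReal).prod
      (P.map fun ω => pathMap hX a b ω - avg ν (pathMap hX a b ω) • (V⁻¹ • avgCov hX a b ν)) := by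
  have hm := measurable_pathMap hX hab
  have hg := (hasGaussianLaw_pathMap hX hab).map_fun (splitMap ν (V⁻¹ • avgCov hX a b ν))
  have hgp := hasGaussianLaw_pathMap hX hab
  set γ := V⁻¹ • avgCov hX a b ν with hγ
  have hma : Measurable fun ω => avg ν (pathMap hX a b ω) := (avg ν).continuous.measurable.comp hm
  have hmY : Measurable fun ω => pathMap hX a b ω - avg ν (pathMap hX a b ω) • γ :=
    hm.sub (hma.smul_const γ)
  have hind : IndepFun (fun ω => avg ν (pathMap hX a b ω))
      (fun ω => pathMap hX a b ω - avg ν (pathMap hX a b ω) • γ) P := by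
    refine HasGaussianLaw.indepFun_of_covariance_strongDual hg fun L₁ L₂ => ?_
    have hL1 (z : ℝ) : L₁ z = L₁ 1 * z := by
      have := L₁.map_smul z 1
      simp only [smul_eq_mul, mul_one] at this
      rw [this, mul_comm]
    have h2 : MemLp (fun ω => L₂ (pathMap hX a b ω)) 2 P := (hgp.map_fun L₂).memLp_two
    have h1 : MemLp (fun ω => avg ν (pathMap hX a b ω)) 2 P := (hgp.map_fun (avg ν)).memLp_two
    have h12 : Integrable (fun ω => avg ν (pathMap hX a b ω) * L₂ (pathMap hX a b ω)) P :=
      h1.integrable_mul h2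
    have h11 : Integrable (fun ω => avg ν (pathMap hX a b ω) ^ 2) P := h1.integrable_sq
    rw [covariance_eq_sub]
    · have e1 : ∫ ω, (L₁ ∘ fun ω => avg ν (pathMap hX a b ω)) ω ∂P = 0 := by
        simp only [Function.comp_def]
        simp_rw [hL1 (avg ν _)]
        rw [integral_const_mul, integral_dual_pathMap hX hab (avg ν), mul_zero]
      rw [e1, zero_mul, sub_zero]
      have e2 : ∀ ω, ((L₁ ∘ fun ω => avg ν (pathMap hX a b ω)) * (L₂ ∘ fun ω =>
          pathMap hX a b ω - avg ν (pathMap hX a b ω) • γ)) ω =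
          L₁ 1 * (avg ν (pathMap hX a b ω) * L₂ (pathMap hX a b ω) -
            avg ν (pathMap hX a b ω) ^ 2 * L₂ γ) := fun ω => by
        simp only [Pi.mul_apply, Function.comp, map_sub, map_smul, smul_eq_mul]
        rw [hL1 (avg ν _)]
        ring
      simp_rw [e2]
      rw [integral_const_mul, integral_sub h12 (h11.mul_const _), integral_mul_const, hVavg,
        ← dual_avgCov hX hab ν L₂, hγ, map_smul, smul_eq_mul]
      field_simp
      ring
    · exact (hg.fst.map_fun L₁).memLp_two
    · exact (hg.snd.map_fun L₂).memLp_two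
  have := hind.map_prod_eq_prod_map_map hma.aemeasurable hmY.aemeasurable
  simp_rw [splitMap_apply]
  rw [this]
  congr 1
  have h3 := (hgp.map_fun (avg ν)).map_eq_gaussianReal
  rw [h3, integral_dual_pathMap hX hab (avg ν), variance_eq_integral hma.aemeasurable,
    integral_dual_pathMap hX hab (avg ν)]
  simp only [sub_zero]
  rw [hVavg]

omit [IsProbabilityMeasure P] ν hV hVavg hab in
lemma lt_pathMin_iff (hX : IsCenteredGaussian X P) (hab : a < b) {u : ℝ} {ω : Ω} :
    u < pathMin X a b ω ↔ ∀ x, u < pathMap hX a b ω x := by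
  have hc : IsCompact ((fun t => X t ω) '' Icc a b) :=
    isCompact_Icc.image (hX.continuous_paths ω)
  have hne : ((fun t => X t ω) '' Icc a b).Nonempty := (nonempty_Icc.2 hab.le).image _
  constructor
  · exact fun h x => h.trans_le (csInf_le hc.bddBelow ⟨x, x.2, rfl⟩)
  · intro h
    obtain ⟨t, ht, hte⟩ := hc.sInf_mem hne
    exact (h ⟨t, ht⟩).trans_eq hte

omit [IsProbabilityMeasure P] ν hV hVavg hab in
lemma measurable_pathMin (hX : IsCenteredGaussian X P) (hab : a < b) : Measurable (pathMin X a b) := by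
  have : Nonempty (Icc a b) := ⟨⟨a, le_rfl, hab.le⟩⟩
  refine measurable_of_Ioi fun u => ?_
  -- With `γ = 1` and `z = 0`, the half-line description of `height` expresses the event through a
  -- continuous function of the path.
  have : pathMin X a b ⁻¹' Ioi u = pathMap hX a b ⁻¹' (height 1 u ⁻¹' Iio 0) := by
    ext ω
    have h1 := setOf_forall_lt_eq_Ioi (γ := (1 : C(Icc a b, ℝ))) (fun _ => le_rfl) u
      (pathMap hX a b ω)
    have h2 := Set.ext_iff.1 h1 0
    simp only [Set.mem_ofPred_eq, mul_zero, zero_add] at h2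
    rw [mem_preimage, mem_Ioi, lt_pathMin_iff hX hab]
    exact h2
  rw [this]
  exact measurable_pathMap hX hab
    ((height_lipschitz (fun _ => le_rfl) u).continuous.measurable measurableSet_Iio)

lemma measureReal_highEvent (hVle : ∀ x, V ≤ avgCov hX a b ν x) (u : ℝ) :
    P.real (highEvent X a b u) = exceedProb (V⁻¹ • avgCov hX a b ν) V.toNNReal
      (P.map fun ω => pathMap hX a b ω - avg ν (pathMap hX a b ω) • (V⁻¹ • avgCov hX a b ν)) u := by
  have : Nonempty (Icc a b) := ⟨⟨a, le_rfl, hab.le⟩⟩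
  have hm := measurable_pathMap hX hab
  have hmap := map_splitMap hX hab ν hV hVavg
  have hγ1 : ∀ x, 1 ≤ (V⁻¹ • avgCov hX a b ν) x := fun x => by
    rw [ContinuousMap.smul_apply, smul_eq_mul, ← div_eq_inv_mul, one_le_div hV]
    exact hVle x
  set γ := V⁻¹ • avgCov hX a b ν
  have hmY : Measurable fun ω => pathMap hX a b ω - avg ν (pathMap hX a b ω) • γ :=
    hm.sub (((avg ν).continuous.measurable.comp hm).smul_const γ)
  set ρ := P.map fun ω => pathMap hX a b ω - avg ν (pathMap hX a b ω) • γ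
  have : IsProbabilityMeasure ρ := Measure.isProbabilityMeasure_map hmY.aemeasurable
  have hh := (height_lipschitz hγ1 u).continuous.measurable
  have hA : MeasurableSet {p : ℝ × C(Icc a b, ℝ) | height γ u p.2 < p.1} :=
    measurableSet_lt (hh.comp measurable_snd) measurable_fst
  have h1 : highEvent X a b u = (fun ω => splitMap ν γ (pathMap hX a b ω)) ⁻¹'
      {p : ℝ × C(Icc a b, ℝ) | height γ u p.2 < p.1} := by
    ext ω
    have h2 := Set.ext_iff.1 (setOf_forall_lt_eq_Ioi hγ1 u
      (pathMap hX a b ω - avg ν (pathMap hX a b ω) • γ)) (avg ν (pathMap hX a b ω))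
    simp only [Set.mem_ofPred_eq, mem_Ioi] at h2
    rw [highEvent, Set.mem_ofPred_eq, lt_pathMin_iff hX hab, mem_preimage, splitMap_apply,
      Set.mem_ofPred_eq, ← h2]
    refine forall_congr' fun x => ?_
    have e : (pathMap hX a b ω - avg ν (pathMap hX a b ω) • γ) x =
      pathMap hX a b ω x - avg ν (pathMap hX a b ω) * γ x := rfl
    rw [e, mul_comm (γ x), add_sub_cancel]
  have hms : Measurable fun ω => splitMap ν γ (pathMap hX a b ω) :=
    (splitMap ν γ).continuous.measurable.comp hm
  rw [h1, ← map_measureReal_apply hms hA, hmap, Measure.real, Measure.prod_apply_symm hA,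
    exceedProb, ← integral_toReal]
  · rfl
  · exact (measurable_measure_prodMk_right hA).aemeasurable
  · exact ae_of_all _ fun y => measure_lt_top _ _

end Decomposition

/-! ### Convergence of tails and the overshoot law -/

lemma expMeasure_real_Ioi {r : ℝ} (hr : 0 < r) (s : ℝ) :
    (expMeasure r).real (Ioi s) = if 0 ≤ s then Real.exp (-(r * s)) else 1 := by
  have := isProbabilityMeasure_expMeasure hr
  have h1 := cdf_expMeasure_eq hr s
  rw [cdf_eq_real] at h1
  rw [← compl_Iic, probReal_compl_eq_one_sub measurableSet_Iic, h1]
  split_ifs <;> ring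

/-- Convergence of the tails implies weak convergence of probability measures on the line. -/
lemma weaklyConverges_of_tendsto_Ioi {law : ℝ → Measure ℝ} {limit : Measure ℝ}
    [hl : ∀ u, IsProbabilityMeasure (law u)] [hlim : IsProbabilityMeasure limit]
    (h : ∀ s, Tendsto (fun u => (law u).real (Ioi s)) atTop (𝓝 (limit.real (Ioi s)))) :
    WeaklyConverges law limit := by
  let law' : ℝ → ProbabilityMeasure ℝ := fun u => ⟨law u, hl u⟩
  let limit' : ProbabilityMeasure ℝ := ⟨limit, hlim⟩
  have hIoc (μ : Measure ℝ) [IsProbabilityMeasure μ] {c d : ℝ} (hcd : c < d) :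
      μ.real (Ioc c d) = μ.real (Ioi c) - μ.real (Ioi d) := by
    rw [← Ioi_sdiff_Ioi, measureReal_sdiff (Ioi_subset_Ioi hcd.le) measurableSet_Ioi]
  have key : Tendsto law' atTop (𝓝 limit') := by
    -- Half-open intervals form a π-system containing arbitrarily small neighbourhoods of each
    -- point, and their masses are differences of tails.
    refine IsPiSystem.tendsto_probabilityMeasure_of_tendsto_of_mem
      (S := {s | ∃ c d : ℝ, c < d ∧ Ioc c d = s}) (isPiSystem_Ioc id id) ?_ ?_ ?_
    · rintro _ ⟨c, d, -, rfl⟩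
      exact measurableSet_Ioc
    · intro U hU x hx
      obtain ⟨ε, hε, hsub⟩ := Metric.isOpen_iff.1 hU x hx
      refine ⟨_, ⟨x - ε / 2, x + ε / 2, by linarith, rfl⟩, Ioc_mem_nhds (by linarith) (by linarith),
        fun y hy => hsub ?_⟩
      rw [Metric.mem_ball, Real.dist_eq, abs_lt]
      constructor <;> linarith [hy.1, hy.2]
    · rintro _ ⟨c, d, hcd, rfl⟩
      rw [← NNReal.tendsto_coe]
      change Tendsto (fun u => (law u).real (Ioc c d)) atTop (𝓝 (limit.real (Ioc c d)))
      rw [hIoc limit hcd]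
      exact ((h c).sub (h d)).congr fun u => (hIoc (law u) hcd).symm
  intro f
  exact ProbabilityMeasure.tendsto_iff_forall_integral_tendsto.1 key f

variable {Ω : Type*} [MeasurableSpace Ω] {X : ℝ → Ω → ℝ} {P : Measure Ω} [IsProbabilityMeasure P]

omit [MeasurableSpace Ω] in
lemma highEvent_anti (X : ℝ → Ω → ℝ) (a b : ℝ) {u u' : ℝ} (h : u ≤ u') :
    highEvent X a b u' ⊆ highEvent X a b u := fun _ hω => lt_of_le_of_lt h hω

/-- If the average `h` of the path over `ν` has variance `V > 0` and covariance at least `V` with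
every value of the path, then all levels are exceeded with positive probability and the scaled
overshoot is asymptotically exponential with mean `V`. -/
theorem overshoot_weaklyConverges (hX : IsCenteredGaussian X P) {a b : ℝ} (hab : a < b)
    (ν : Measure (Icc a b)) [IsProbabilityMeasure ν] {V : ℝ} (hV : 0 < V)
    (hVavg : ∫ ω, avg ν (pathMap hX a b ω) ^ 2 ∂P = V) (hVle : ∀ x, V ≤ avgCov hX a b ν x) :
    (∀ u, 0 < P (highEvent X a b u)) ∧
      WeaklyConverges (overshootLaw X P a b) (expMeasure V⁻¹) := by
  have hne : Nonempty (Icc a b) := ⟨⟨a, le_rfl, hab.le⟩⟩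
  have hm := measurable_pathMap hX hab
  have hprob := measureReal_highEvent hX hab ν hV hVavg hVle
  have hγν := avg_avgCov hX hab ν hV hVavg
  have hγ1 : ∀ x, 1 ≤ (V⁻¹ • avgCov hX a b ν) x := fun x => by
    rw [ContinuousMap.smul_apply, smul_eq_mul, ← div_eq_inv_mul, one_le_div hV]
    exact hVle x
  set γ := V⁻¹ • avgCov hX a b ν
  let M : C(Icc a b, ℝ) →L[ℝ] C(Icc a b, ℝ) :=
    ContinuousLinearMap.id ℝ _ - (avg ν).smulRight γ
  have hM (f : C(Icc a b, ℝ)) : M f = f - avg ν f • γ := rfl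
  simp_rw [← hM] at hprob
  have hmM : Measurable fun ω => M (pathMap hX a b ω) := M.continuous.measurable.comp hm
  have hgauss : IsGaussian (P.map fun ω => M (pathMap hX a b ω)) :=
    ((hasGaussianLaw_pathMap hX hab).map_fun M).isGaussian_map
  have hρ : ∀ᵐ y ∂(P.map fun ω => M (pathMap hX a b ω)), ∀ u, u ≤ height γ u y := by
    have h1 : ∀ᵐ y ∂(P.map fun ω => M (pathMap hX a b ω)), avg ν y = 0 := by
      refine (ae_map_iff hmM.aemeasurable
        ((avg ν).continuous.measurable (measurableSet_singleton (0 : ℝ)))).2 (ae_of_all _ fun ω => ?_)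
      change avg ν (M (pathMap hX a b ω)) = 0
      rw [hM, map_sub, map_smul, hγν, smul_eq_mul, mul_one, sub_self]
    filter_upwards [h1] with y hy u using le_height_of_avg_eq_zero hγ1 hγν hy u
  set ρ := P.map fun ω => M (pathMap hX a b ω)
  have hv : V.toNNReal ≠ 0 := (Real.toNNReal_pos.2 hV).ne'
  have hvV : (V.toNNReal : ℝ) = V := Real.coe_toNNReal V hV.le
  obtain ⟨C, hC, hint⟩ := IsGaussian.exists_integrable_exp_sq ρ
  obtain ⟨B, -, hB⟩ := exists_half_le_measureReal_norm_le hC hint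
  have hpos0 {u : ℝ} (hu : 0 ≤ u) : 0 < P.real (highEvent X a b u) := by
    rw [hprob]
    exact exceedProb_pos hγ1 hv (hB.trans_lt' (by norm_num)) hu
  have hpos (u : ℝ) : 0 < P.real (highEvent X a b u) :=
    (hpos0 (le_max_right u 0)).trans_le (measureReal_mono (highEvent_anti X a b (le_max_left u 0)))
  have hposP (u : ℝ) : 0 < P (highEvent X a b u) := (ENNReal.toReal_pos_iff.1 (hpos u)).1
  refine ⟨hposP, ?_⟩
  have hmmin : Measurable (pathMin X a b) := measurable_pathMin hX hab
  have hmE (u : ℝ) : MeasurableSet (highEvent X a b u) := hmmin measurableSet_Ioi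
  have hmo (u : ℝ) : Measurable fun ω => u * (pathMin X a b ω - u) := by fun_prop
  have hlaw (u : ℝ) : IsProbabilityMeasure (overshootLaw X P a b u) := by
    have := cond_isProbabilityMeasure (hposP u).ne'
    exact Measure.isProbabilityMeasure_map (hmo u).aemeasurable
  have hexp := isProbabilityMeasure_expMeasure (inv_pos.2 hV)
  refine weaklyConverges_of_tendsto_Ioi fun s => ?_
  have hlawIoi {u : ℝ} (hu : 0 < u) : (overshootLaw X P a b u).real (Ioi s) =
      P.real (highEvent X a b u ∩ highEvent X a b (u + s / u)) / P.real (highEvent X a b u) := by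
    rw [overshootLaw, map_measureReal_apply (hmo u) measurableSet_Ioi, Measure.real, cond_apply (hmE u),
      ENNReal.toReal_mul, ENNReal.toReal_inv, div_eq_inv_mul]
    congr 4
    ext ω
    rw [mem_preimage, mem_Ioi, highEvent, Set.mem_ofPred_eq, ← lt_sub_iff_add_lt',
      div_lt_iff₀' hu]
  rw [expMeasure_real_Ioi (inv_pos.2 hV)]
  split_ifs with hs
  · have := tendsto_exceedProb_ratio hγ1 hv hρ hC hint hs
    rw [hvV] at this
    rw [← div_eq_inv_mul]
    refine this.congr' ?_
    filter_upwards [eventually_gt_atTop 0] with u hu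
    rw [hlawIoi hu, inter_eq_right.2 (highEvent_anti X a b (by simp; positivity)), hprob, hprob]
  -- For `s < 0` the level `u + s/u` lies below `u`, so the conditional probability is exactly 1.
  · refine tendsto_const_nhds.congr' ?_
    filter_upwards [eventually_gt_atTop 0] with u hu
    have : u + s / u ≤ u := by
      have := div_neg_of_neg_of_pos (not_le.1 hs) hu
      linarith
    rw [hlawIoi hu, inter_eq_left.2 (highEvent_anti X a b this), div_self (hpos u).ne']

/-! ### Potentials, mixtures, and measures on the interval -/

/-- The potential `t ↦ ∫ R(s,t) μ(ds)` of a measure. -/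
def potential (R : ℝ → ℝ → ℝ) (μ : Measure ℝ) (t : ℝ) : ℝ := ∫ s, R s t ∂μ

section Transfer

variable {a b : ℝ}

lemma IsProbOn.exists_map {μ : Measure ℝ} (hμ : IsProbOn a b μ) :
    ∃ ν : Measure (Icc a b), IsProbabilityMeasure ν ∧ ν.map Subtype.val = μ := by
  have h1 : (μ.comap (Subtype.val : Icc a b → ℝ)).map Subtype.val = μ := by
    have h2 : ∀ᵐ x ∂μ, x ∈ Icc a b := mem_ae_iff.2 hμ.compl_null
    rw [map_comap_subtype_coe measurableSet_Icc, Measure.restrict_eq_self_of_ae_mem h2]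
  have := hμ.prob
  refine ⟨_, ⟨?_⟩, h1⟩
  have h2 := measure_univ (μ := μ)
  rwa [← h1, Measure.map_apply measurable_subtype_coe .univ, preimage_univ] at h2

lemma isProbOn_map (ν : Measure (Icc a b)) [IsProbabilityMeasure ν] :
    IsProbOn a b (ν.map Subtype.val) := by
  refine ⟨Measure.isProbabilityMeasure_map measurable_subtype_coe.aemeasurable, ?_⟩
  rw [Measure.map_apply measurable_subtype_coe measurableSet_Icc.compl]
  convert measure_empty (μ := ν)
  ext x
  simp

lemma integral_map_val (ν : Measure (Icc a b)) (f : ℝ → ℝ) :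
    ∫ s, f s ∂(ν.map Subtype.val) = ∫ x : Icc a b, f x ∂ν :=
  (MeasurableEmbedding.subtype_coe measurableSet_Icc).integral_map f

end Transfer

section Mix

variable {K : Type*} [TopologicalSpace K] [CompactSpace K] [MeasurableSpace K] [BorelSpace K]

/-- A convex combination of two measures. -/
def mix (ε : ℝ) (ν ν' : Measure K) : Measure K :=
  ENNReal.ofReal (1 - ε) • ν + ENNReal.ofReal ε • ν'

omit [TopologicalSpace K] [CompactSpace K] [BorelSpace K] in
lemma isProbabilityMeasure_mix {ε : ℝ} (h0 : 0 ≤ ε) (h1 : ε ≤ 1) (ν ν' : Measure K)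
    [IsProbabilityMeasure ν] [IsProbabilityMeasure ν'] : IsProbabilityMeasure (mix ε ν ν') := by
  refine ⟨?_⟩
  simp only [mix, Measure.add_apply, Measure.smul_apply, measure_univ, smul_eq_mul, mul_one]
  rw [← ENNReal.ofReal_add (by linarith) h0]
  simp

lemma integral_mix {ε : ℝ} (h0 : 0 ≤ ε) (h1 : ε ≤ 1) (ν ν' : Measure K)
    [IsProbabilityMeasure ν] [IsProbabilityMeasure ν'] (f : C(K, ℝ)) :
    ∫ x, f x ∂(mix ε ν ν') = (1 - ε) * avg ν f + ε * avg ν' f := by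
  rw [mix, integral_add_measure, integral_smul_measure, integral_smul_measure,
    ENNReal.toReal_ofReal (by linarith), ENNReal.toReal_ofReal h0]
  · rfl
  · exact (integrable_continuousMap ν f).smul_measure ENNReal.ofReal_ne_top
  · exact (integrable_continuousMap ν' f).smul_measure ENNReal.ofReal_ne_top

end Mix

/-! ### The energy minimization problem -/

section Energy

variable {Ω : Type*} [MeasurableSpace Ω] {X : ℝ → Ω → ℝ} {P : Measure Ω} [IsProbabilityMeasure P]
  (hX : IsCenteredGaussian X P) {a b : ℝ} (hab : a < b)

omit [IsProbabilityMeasure P] in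
lemma memLp_two (hX : IsCenteredGaussian X P) (t : ℝ) : MemLp (X t) 2 P :=
  (hX.gaussian.hasGaussianLaw_eval t).memLp_two

omit [IsProbabilityMeasure P] in
lemma covFun_comm (X : ℝ → Ω → ℝ) (s t : ℝ) : covFun X P s t = covFun X P t s := by
  simp only [covFun, mul_comm]

include hab

lemma memLp_avg (ν : Measure (Icc a b)) [IsProbabilityMeasure ν] :
    MemLp (fun ω => avg ν (pathMap hX a b ω)) 2 P :=
  ((hasGaussianLaw_pathMap hX hab).map_fun (avg ν)).memLp_two

lemma integrable_smul_pathMap (t : ℝ) : Integrable (fun ω => X t ω • pathMap hX a b ω) P := by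
  have hm := measurable_pathMap hX hab
  refine (((memLp_two hX t).integrable_sq).add (integrable_norm_pathMap_sq hX hab)).mono'
    ((hX.measurable t).smul hm).aestronglyMeasurable (ae_of_all _ fun ω => ?_)
  rw [norm_smul, Real.norm_eq_abs, Pi.add_apply, ← sq_abs (X t ω)]
  nlinarith [sq_nonneg (|X t ω| - ‖pathMap hX a b ω‖), sq_nonneg |X t ω|,
    sq_nonneg ‖pathMap hX a b ω‖]

lemma potential_map (ν : Measure (Icc a b)) [IsProbabilityMeasure ν] (t : ℝ) :
    potential (covFun X P) (ν.map Subtype.val) t =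
      ∫ ω, avg ν (pathMap hX a b ω) * X t ω ∂P := by
  have hi := integrable_smul_pathMap hX hab t
  have h1 (x : Icc a b) : covFun X P x t = (∫ ω, X t ω • pathMap hX a b ω ∂P) x := by
    have := (ContinuousMap.evalCLM ℝ x).integral_comp_comm hi
    rw [covFun_comm, covFun]
    simpa using this
  rw [potential, integral_map_val]
  simp_rw [h1]
  rw [← avg_apply, ← (avg ν).integral_comp_comm hi]
  simp [mul_comm]

lemma potential_map_coe (ν : Measure (Icc a b)) [IsProbabilityMeasure ν] (x : Icc a b) :
    potential (covFun X P) (ν.map Subtype.val) x = avgCov hX a b ν x := by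
  rw [potential_map hX hab, avgCov_apply hX hab]

/-- The energy is the second moment of the averaged path; this turns statements about the quadratic
form into Hilbert space arguments in `L²(P)`. -/
lemma energy_map (ν : Measure (Icc a b)) [IsProbabilityMeasure ν] :
    energy (covFun X P) (ν.map Subtype.val) = ∫ ω, avg ν (pathMap hX a b ω) ^ 2 ∂P := by
  have h1 (s : ℝ) : ∫ t, covFun X P s t ∂(ν.map Subtype.val) =
      potential (covFun X P) (ν.map Subtype.val) s := by
    simp only [potential, covFun_comm X s]
  rw [energy]
  simp_rw [h1]
  rw [integral_map_val]
  simp_rw [potential_map_coe hX hab]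
  rw [← avg_apply, dual_avgCov hX hab]
  simp only [sq]

/-- Probability measures on `[a,b]` are weakly compact, and the energy is weakly continuous by
dominated convergence with bound `‖pathMap hX a b ω‖ ^ 2`. -/
theorem exists_isMinimizer (hX : IsCenteredGaussian X P) :
    ∃ μ : Measure ℝ, IsMinimizer (covFun X P) a b μ := by
  have hneP : Nonempty (ProbabilityMeasure (Icc a b)) :=
    ⟨⟨Measure.dirac ⟨a, le_rfl, hab.le⟩, inferInstance⟩⟩
  have hcont : Continuous fun ν : ProbabilityMeasure (Icc a b) =>
      ∫ ω, avg (ν : Measure (Icc a b)) (pathMap hX a b ω) ^ 2 ∂P := by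
    refine continuous_of_dominated (bound := fun ω => ‖pathMap hX a b ω‖ ^ 2) (fun ν => ?_)
      (fun ν => ae_of_all _ fun ω => ?_) (integrable_norm_pathMap_sq hX hab)
      (ae_of_all _ fun ω => ?_)
    · exact ((memLp_avg hX hab _).integrable_sq).aestronglyMeasurable
    · rw [norm_pow]
      exact pow_le_pow_left₀ (norm_nonneg _) (abs_avg_le _ _) 2
    · exact (ProbabilityMeasure.continuous_integral_boundedContinuousFunction
        (BoundedContinuousFunction.mkOfCompact (pathMap hX a b ω))).pow 2
  obtain ⟨ν, -, hν⟩ := isCompact_univ.exists_isMinOn univ_nonempty hcont.continuousOn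
  refine ⟨(ν : Measure (Icc a b)).map Subtype.val, isProbOn_map _, fun μ' hμ' => ?_⟩
  obtain ⟨ν', hν', rfl⟩ := hμ'.exists_map
  rw [energy_map hX hab, energy_map hX hab]
  exact hν (mem_univ (⟨ν', hν'⟩ : ProbabilityMeasure (Icc a b)))

omit [IsProbabilityMeasure P] hab in
lemma IsMinimizer.optimalValue_eq {R : ℝ → ℝ → ℝ} {μ : Measure ℝ} (hμ : IsMinimizer R a b μ) :
    optimalValue R a b = energy R μ :=
  (IsLeast.csInf_eq ⟨⟨μ, hμ.probOn, rfl⟩, by rintro _ ⟨μ', hμ', rfl⟩; exact hμ.le μ' hμ'⟩)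

lemma energy_nonneg (hX : IsCenteredGaussian X P) {μ : Measure ℝ} (hμ : IsProbOn a b μ) :
    0 ≤ energy (covFun X P) μ := by
  obtain ⟨ν, hν, rfl⟩ := hμ.exists_map
  rw [energy_map hX hab]
  exact integral_nonneg fun ω => sq_nonneg _

lemma energy_mix {ε : ℝ} (h0 : 0 ≤ ε) (h1 : ε ≤ 1) (ν ν' : Measure (Icc a b))
    [IsProbabilityMeasure ν] [IsProbabilityMeasure ν'] :
    energy (covFun X P) ((mix ε ν ν').map Subtype.val) =
      (1 - ε) ^ 2 * energy (covFun X P) (ν.map Subtype.val) +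
      2 * ε * (1 - ε) * ∫ ω, avg ν (pathMap hX a b ω) * avg ν' (pathMap hX a b ω) ∂P +
      ε ^ 2 * energy (covFun X P) (ν'.map Subtype.val) := by
  have := isProbabilityMeasure_mix h0 h1 ν ν'
  have hL := memLp_avg hX hab ν
  have hL' := memLp_avg hX hab ν'
  simp_rw [energy_map hX hab]
  simp_rw [avg_apply (mix ε ν ν'), integral_mix h0 h1]
  rw [← integral_const_mul, ← integral_const_mul, ← integral_const_mul, ← integral_add,
    ← integral_add]
  · congr 1 with ω
    ring
  · exact (hL.integrable_sq.const_mul _).add ((hL.integrable_mul hL').const_mul _)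
  · exact hL'.integrable_sq.const_mul _
  · exact hL.integrable_sq.const_mul _
  · exact (hL.integrable_mul hL').const_mul _

/-- The minimizer's potential is at least the minimal energy on the whole interval. -/
lemma IsMinimizer.le_potential (hX : IsCenteredGaussian X P) {μ : Measure ℝ}
    (hμ : IsMinimizer (covFun X P) a b μ) {t : ℝ} (ht : t ∈ Icc a b) :
    energy (covFun X P) μ ≤ potential (covFun X P) μ t := by
  obtain ⟨ν, hν, rfl⟩ := hμ.probOn.exists_map
  set V := energy (covFun X P) (ν.map Subtype.val) with hV
  set g := potential (covFun X P) (ν.map Subtype.val) t with hg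
  set r := energy (covFun X P) ((Measure.dirac (⟨t, ht⟩ : Icc a b)).map Subtype.val) with hr
  -- Move mass `ε` towards the Dirac measure at `t`, divide the energy increment by `ε`, and let `ε
  -- → 0`.
  have key (ε : ℝ) (h0 : 0 < ε) (h1 : ε ≤ 1) : 0 ≤ 2 * (g - V) + ε * (V - 2 * g + r) := by
    have := isProbabilityMeasure_mix h0.le h1 ν (Measure.dirac (⟨t, ht⟩ : Icc a b))
    have h2 := hμ.le _ (isProbOn_map (mix ε ν (Measure.dirac (⟨t, ht⟩ : Icc a b))))
    rw [energy_mix hX hab h0.le h1, ← hV, ← hr] at h2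
    have h3 : ∫ ω, avg ν (pathMap hX a b ω) *
        avg (Measure.dirac (⟨t, ht⟩ : Icc a b)) (pathMap hX a b ω) ∂P = g := by
      rw [hg, potential_map hX hab]
      simp [avg_apply (Measure.dirac (⟨t, ht⟩ : Icc a b))]
    rw [h3] at h2
    have h4 : 0 ≤ ε * (2 * (g - V) + ε * (V - 2 * g + r)) := by linarith
    exact nonneg_of_mul_nonneg_right h4 h0
  have hlim : Tendsto (fun ε : ℝ => 2 * (g - V) + ε * (V - 2 * g + r)) (𝓝[>] 0)
      (𝓝 (2 * (g - V) + 0 * (V - 2 * g + r))) :=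
    (Continuous.tendsto (by fun_prop) 0).mono_left nhdsWithin_le_nhds
  have h5 := ge_of_tendsto hlim (by
    filter_upwards [Ioc_mem_nhdsGT (zero_lt_one' ℝ)] with ε hε using key ε hε.1 hε.2)
  linarith

omit [IsProbabilityMeasure P] hab in
lemma IsMinimizer.support_subset (hμ : IsMinimizer (covFun X P) a b μ) : μ.support ⊆ Icc a b :=
  Measure.support_subset_of_isClosed isClosed_Icc (mem_ae_iff.2 hμ.probOn.compl_null)

/-- The minimizer's potential equals the minimal energy on the support. -/
lemma IsMinimizer.potential_eq (hX : IsCenteredGaussian X P) {μ : Measure ℝ}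
    (hμ : IsMinimizer (covFun X P) a b μ) {t : ℝ} (ht : t ∈ μ.support) :
    potential (covFun X P) μ t = energy (covFun X P) μ := by
  have hle := fun (x : Icc a b) => hμ.le_potential hab hX x.2
  obtain ⟨ν, hν, rfl⟩ := hμ.probOn.exists_map
  simp_rw [potential_map_coe hX hab] at hle
  set V := energy (covFun X P) (ν.map Subtype.val) with hV
  have h0 : ∫ x, (avgCov hX a b ν x - V) ∂ν = 0 := by
    rw [integral_sub (integrable_continuousMap ν _) (integrable_const _), ← avg_apply,
      dual_avgCov hX hab, hV, energy_map hX hab]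
    simp [sq]
  have h1 : ∀ᵐ x ∂ν, avgCov hX a b ν x = V := by
    have := (integral_eq_zero_iff_of_nonneg (fun x => sub_nonneg.2 (hle x))
      ((integrable_continuousMap ν _).sub (integrable_const _))).1 h0
    filter_upwards [this] with x hx
    simpa [sub_eq_zero] using hx
  -- A nonnegative function of mean zero vanishes almost everywhere; its zero set is closed of full
  -- measure, so it contains the support.
  have hcl : IsClosed (Subtype.val '' {x : Icc a b | avgCov hX a b ν x = V}) :=
    isClosed_Icc.isClosedEmbedding_subtypeVal.isClosedMap _
      (isClosed_eq (avgCov hX a b ν).continuous continuous_const)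
  have hae : Subtype.val '' {x : Icc a b | avgCov hX a b ν x = V} ∈ ae (ν.map Subtype.val) := by
    rw [mem_ae_map_iff measurable_subtype_coe.aemeasurable hcl.measurableSet,
      preimage_image_eq _ Subtype.val_injective]
    exact h1
  obtain ⟨x, hx, rfl⟩ := Measure.support_subset_of_isClosed hcl hae ht
  rw [potential_map_coe hX hab]
  exact hx

/-- Two minimizers have the same potential. -/
lemma IsMinimizer.potential_congr (hX : IsCenteredGaussian X P) {μ μ' : Measure ℝ}
    (hμ : IsMinimizer (covFun X P) a b μ) (hμ' : IsMinimizer (covFun X P) a b μ') (t : ℝ) :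
    potential (covFun X P) μ t = potential (covFun X P) μ' t := by
  have hVV : energy (covFun X P) μ = energy (covFun X P) μ' :=
    le_antisymm (hμ.le _ hμ'.probOn) (hμ'.le _ hμ.probOn)
  obtain ⟨ν, hν, rfl⟩ := hμ.probOn.exists_map
  obtain ⟨ν', hν', rfl⟩ := hμ'.probOn.exists_map
  have hL := memLp_avg hX hab ν
  have hL' := memLp_avg hX hab ν'
  have := isProbabilityMeasure_mix (ε := 1 / 2) (by norm_num) (by norm_num) ν ν'
  -- The midpoint has energy at least the minimum, so by the parallelogram identity the two averages
  -- coincide in `L²(P)`.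
  have h2 := hμ.le _ (isProbOn_map (mix (1 / 2) ν ν'))
  rw [energy_mix hX hab (by norm_num) (by norm_num)] at h2
  have h3 : ∫ ω, (avg ν (pathMap hX a b ω) - avg ν' (pathMap hX a b ω)) ^ 2 ∂P =
      energy (covFun X P) (ν.map Subtype.val) -
      2 * ∫ ω, avg ν (pathMap hX a b ω) * avg ν' (pathMap hX a b ω) ∂P +
      energy (covFun X P) (ν'.map Subtype.val) := by
    rw [energy_map hX hab, energy_map hX hab, ← integral_const_mul, ← integral_sub, ← integral_add]
    · congr 1 with ω
      ring
    · exact hL.integrable_sq.sub ((hL.integrable_mul hL').const_mul _)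
    · exact hL'.integrable_sq
    · exact hL.integrable_sq
    · exact (hL.integrable_mul hL').const_mul _
  have h4 : ∫ ω, (avg ν (pathMap hX a b ω) - avg ν' (pathMap hX a b ω)) ^ 2 ∂P = 0 :=
    le_antisymm (by linarith) (integral_nonneg fun ω => sq_nonneg _)
  have h5 := (integral_eq_zero_iff_of_nonneg (fun ω => sq_nonneg _) (hL.sub hL').integrable_sq).1 h4
  rw [potential_map hX hab, potential_map hX hab]
  refine integral_congr_ae ?_
  filter_upwards [h5] with ω hω
  have : avg ν (pathMap hX a b ω) - avg ν' (pathMap hX a b ω) = 0 := by simpa using hω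
  rw [sub_eq_zero.1 this]

lemma potential_eq_zero_of_energy_eq_zero (hX : IsCenteredGaussian X P) {μ : Measure ℝ}
    (hμ : IsProbOn a b μ) (h0 : energy (covFun X P) μ = 0) (t : ℝ) :
    potential (covFun X P) μ t = 0 := by
  obtain ⟨ν, hν, rfl⟩ := hμ.exists_map
  rw [energy_map hX hab] at h0
  have h5 := (integral_eq_zero_iff_of_nonneg (fun ω => sq_nonneg _)
    (memLp_avg hX hab ν).integrable_sq).1 h0
  rw [potential_map hX hab]
  refine integral_eq_zero_of_ae ?_
  filter_upwards [h5] with ω hω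
  have : avg ν (pathMap hX a b ω) = 0 := by simpa using hω
  simp [this]

/-- The high-level behaviour of the minimum, given a minimizer of positive energy. -/
theorem IsMinimizer.overshoot (hX : IsCenteredGaussian X P) {μ : Measure ℝ}
    (hμ : IsMinimizer (covFun X P) a b μ) (hpos : 0 < energy (covFun X P) μ) :
    (∀ u, 0 < P (highEvent X a b u)) ∧
      WeaklyConverges (overshootLaw X P a b) (expMeasure (energy (covFun X P) μ)⁻¹) := by
  have hle := fun (x : Icc a b) => hμ.le_potential hab hX x.2
  obtain ⟨ν, hν, rfl⟩ := hμ.probOn.exists_map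
  simp_rw [potential_map_coe hX hab] at hle
  exact overshoot_weaklyConverges hX hab ν hpos (energy_map hX hab ν).symm hle

end Energy

/-! ### Analytic potentials from a power expansion -/

lemma analyticOnNhd_of_hasSum_pow {f : ℝ → ℝ} {c : ℕ → ℝ}
    (h : ∀ t, HasSum (fun n => c n * t ^ n) (f t)) : AnalyticOnNhd ℝ f univ := by
  have hball : HasFPowerSeriesOnBall f (FormalMultilinearSeries.ofScalars ℝ c) 0 ⊤ := by
    refine ⟨le_of_eq (Eq.symm ?_), ENNReal.zero_lt_top, fun {y} _ => ?_⟩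
    · refine FormalMultilinearSeries.radius_eq_top_of_summable_norm _ fun r => ?_
      refine ((h r).summable.norm).congr fun n => ?_
      rw [FormalMultilinearSeries.ofScalars_norm, norm_mul, norm_pow, NNReal.norm_eq]
    · rw [zero_add]
      refine (h y).congr_fun ?_
      intro n
      simp [mul_comm]
  have := hball.analyticOnNhd
  rwa [Metric.eball_top] at this

section PowerExpansion

variable {R : ℝ → ℝ → ℝ} {a b : ℝ}

/-- Integrate the double series termwise, dominated by its absolute value at `(C, |t|)`, and regroup
by powers of `t`. -/
lemma HasPowerExpansion.analyticOnNhd_potential (hR : HasPowerExpansion R) {μ : Measure ℝ}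
    (hμ : IsProbOn a b μ) : AnalyticOnNhd ℝ (potential R μ) univ := by
  obtain ⟨r, hr⟩ := hR
  have := hμ.prob
  have hae : ∀ᵐ s ∂μ, s ∈ Icc a b := mem_ae_iff.2 hμ.compl_null
  set C := max |a| |b| with hC
  have hsC {s : ℝ} (hs : s ∈ Icc a b) : |s| ≤ C := abs_le_max_abs_abs hs.1 hs.2
  have hC0 : 0 ≤ C := (abs_nonneg a).trans (le_max_left _ _)
  have hbound (t : ℝ) (p : ℕ × ℕ) : ∀ᵐ s ∂μ,
      ‖r p.1 p.2 * s ^ p.1 * t ^ p.2‖ ≤ ‖r p.1 p.2 * C ^ p.1 * |t| ^ p.2‖ := by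
    filter_upwards [hae] with s hs
    simp only [norm_mul, norm_pow, Real.norm_eq_abs, abs_abs, abs_of_nonneg hC0]
    have := hsC hs
    gcongr
  have hint (t : ℝ) (p : ℕ × ℕ) : Integrable (fun s => r p.1 p.2 * s ^ p.1 * t ^ p.2) μ :=
    (integrable_const _).mono' (by fun_prop) (hbound t p)
  have hsum (t : ℝ) : HasSum (fun p : ℕ × ℕ => r p.1 p.2 * (∫ s, s ^ p.1 ∂μ) * t ^ p.2)
      (potential R μ t) := by
    have h1 : Summable fun p : ℕ × ℕ => ∫ s, ‖r p.1 p.2 * s ^ p.1 * t ^ p.2‖ ∂μ := by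
      refine Summable.of_nonneg_of_le (fun p => integral_nonneg fun s => norm_nonneg _)
        (fun p => ?_) (hr C |t|).summable.norm
      refine (integral_mono_ae (hint t p).norm (integrable_const _) (hbound t p)).trans ?_
      simp
    have h2 := hasSum_integral_of_summable_integral_norm (hint t) h1
    simp_rw [fun s => (hr s t).tsum_eq] at h2
    refine h2.congr_fun ?_
    intro p
    rw [integral_mul_const, integral_const_mul]
  refine analyticOnNhd_of_hasSum_pow (c := fun n => ∑' m, r m n * ∫ s, s ^ m ∂μ) fun t => ?_
  -- At `t = 1` the factor `t ^ n` disappears, so this gives summability of the series defining each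
  -- coefficient.
  have h1 := (Equiv.prodComm ℕ ℕ).hasSum_iff.2 (hsum 1)
  have h3 := (Equiv.prodComm ℕ ℕ).hasSum_iff.2 (hsum t)
  refine h3.prod_fiberwise fun n => ?_
  have h4 := (h1.summable.prod_factor n).hasSum
  simp only [Function.comp, Equiv.prodComm_apply, Prod.swap, one_pow, mul_one] at h4 ⊢
  exact h4.mul_right _

end PowerExpansion

/-! ### Potentials through the spectral measure -/

section Spectral

open Complex

variable {F : Measure ℝ}

lemma norm_exp_mul_le (z : ℂ) (x K : ℝ) (hz : ‖z‖ ≤ K) :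
    ‖cexp (z * x)‖ ≤ Real.exp (K * x) + Real.exp (-K * x) := by
  rw [norm_exp]
  have h1 : (z * x).re = z.re * x := by simp
  rw [h1]
  have h2 : z.re * x ≤ K * |x| := by
    refine (le_abs_self _).trans ?_
    rw [abs_mul]
    exact mul_le_mul_of_nonneg_right ((abs_re_le_norm z).trans hz) (abs_nonneg x)
  refine (Real.exp_le_exp.2 h2).trans ?_
  rcases abs_cases x with ⟨h, -⟩ | ⟨h, -⟩ <;> rw [h]
  · linarith [Real.exp_pos (-K * x)]
  · rw [mul_neg, ← neg_mul]
    linarith [Real.exp_pos (K * x)]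

lemma differentiable_integral_exp_mul (hF : ∀ t : ℝ, Integrable (fun x => Real.exp (t * x)) F)
    {c : ℝ → ℂ} {B : ℝ} (hc : Measurable c) (hcB : ∀ x, ‖c x‖ ≤ B) :
    Differentiable ℂ fun z : ℂ => ∫ x, cexp (z * x) * c x ∂F := by
  intro z₀
  have hB : 0 ≤ B := (norm_nonneg _).trans (hcB 0)
  have hm (z : ℂ) : Measurable fun x : ℝ => cexp (z * x) * c x := by fun_prop
  have hm' : Measurable fun x : ℝ => x * cexp (z₀ * x) * c x := by fun_prop
  set K := ‖z₀‖ + 1 with hK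
  -- This is `(e^x + e^(-x)) (e^(Kx) + e^(-Kx)) B` expanded: the first factor absorbs the `x`
  -- produced by differentiation, and every term is an exponential moment of `F`.
  set bd : ℝ → ℝ := fun x => ((Real.exp ((K + 1) * x) + Real.exp ((K - 1) * x)) +
    (Real.exp ((-K + 1) * x) + Real.exp ((-K - 1) * x))) * B
  have hbd : Integrable bd F := (((hF _).add (hF _)).add ((hF _).add (hF _))).mul_const B
  have habs (x : ℝ) : |x| ≤ Real.exp x + Real.exp (-x) := by
    have h1 := Real.add_one_le_exp |x|
    rcases abs_cases x with ⟨h, -⟩ | ⟨h, -⟩ <;> rw [h] at h1 ⊢ <;>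
      linarith [Real.exp_pos x, Real.exp_pos (-x)]
  refine (hasDerivAt_integral_of_dominated_loc_of_deriv_le (bound := bd)
    (F' := fun z x => x * cexp (z * x) * c x) (Metric.ball_mem_nhds z₀ one_pos)
    (Eventually.of_forall fun z => (hm z).aestronglyMeasurable) ?_ hm'.aestronglyMeasurable
    (ae_of_all _ fun x z hz => ?_) hbd (ae_of_all _ fun x z _ => ?_)).2.differentiableAt
  · refine (((hF ‖z₀‖).add (hF (-‖z₀‖))).mul_const B).mono' (hm z₀).aestronglyMeasurable
      (ae_of_all _ fun x => ?_)
    rw [norm_mul]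
    exact mul_le_mul (norm_exp_mul_le z₀ x _ le_rfl) (hcB x) (norm_nonneg _)
      (add_pos (Real.exp_pos _) (Real.exp_pos _)).le
  · have hz' : ‖z‖ ≤ K := by
      have := norm_le_norm_add_norm_sub' z z₀
      rw [Metric.mem_ball, dist_eq_norm] at hz
      linarith
    rw [norm_mul, norm_mul, norm_real, Real.norm_eq_abs]
    refine mul_le_mul ?_ (hcB x) (norm_nonneg _) (by positivity)
    refine (mul_le_mul (habs x) (norm_exp_mul_le z x K hz') (norm_nonneg _)
      (by positivity)).trans (le_of_eq ?_)
    simp only [add_mul, sub_mul, Real.exp_add, Real.exp_sub, neg_mul, one_mul, Real.exp_neg]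
    ring
  · have h1 : HasDerivAt (fun z : ℂ => z * (x : ℂ)) (x : ℂ) z := by
      simpa using (hasDerivAt_id z).mul_const (x : ℂ)
    have h2 := (h1.cexp).mul_const (c x)
    rwa [mul_comm (cexp _)] at h2

variable [IsFiniteMeasure F] {Ω : Type*} [MeasurableSpace Ω] {X : ℝ → Ω → ℝ} {P : Measure Ω}

lemma potential_eq_integral_charFun (hS : IsSpectralMeasure X P F) (μ : Measure ℝ)
    [IsFiniteMeasure μ] (t : ℝ) :
    ((potential (covFun X P) μ t : ℝ) : ℂ) =
      ∫ x, cexp (((t : ℂ) * I) * x) * charFun μ (-x) ∂F := by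
  rw [potential, ← integral_complex_ofReal]
  simp_rw [hS.cov_eq]
  rw [integral_integral_swap]
  · congr 1 with x
    rw [charFun_apply_real, ← integral_const_mul]
    congr 1 with s
    rw [← Complex.exp_add]
    congr 1
    push_cast
    ring
  · refine (integrable_const (1 : ℝ)).mono' (by fun_prop) (ae_of_all _ fun p => ?_)
    rw [Function.uncurry, mul_comm, norm_exp_ofReal_mul_I]

lemma IsSpectralMeasure.analyticOnNhd_potential (hS : IsSpectralMeasure X P F)
    (hF : ∀ t : ℝ, Integrable (fun x => Real.exp (t * x)) F) (μ : Measure ℝ)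
    [IsProbabilityMeasure μ] : AnalyticOnNhd ℝ (potential (covFun X P) μ) univ := by
  have hd := differentiable_integral_exp_mul hF (c := fun x => charFun μ (-x)) (B := 1)
    (by fun_prop) (fun x => norm_charFun_le_one _)
  intro t _
  have h1 : AnalyticAt ℝ (fun z : ℂ => ∫ x, cexp (z * x) * charFun μ (-x) ∂F) ((t : ℂ) * I) :=
    (hd.analyticAt _).restrictScalars
  have h2 : AnalyticAt ℝ (fun t : ℝ => (t : ℂ) * I) t :=
    (ofRealCLM.analyticAt t).mul analyticAt_const
  have h3 := (reCLM.analyticAt _).comp (AnalyticAt.comp (f := fun t : ℝ => (t : ℂ) * I) h1 h2)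
  refine h3.congr (Eventually.of_forall fun t => ?_)
  simp only [Function.comp, ← potential_eq_integral_charFun hS μ, reCLM_apply, ofReal_re]

/-- Bounded support gives all exponential moments, so the complex moment generating function is
analytic along the imaginary axis. -/
lemma analyticOnNhd_charFun_of_compl_Icc {a b : ℝ} (μ : Measure ℝ) [IsFiniteMeasure μ]
    (hμ : μ (Icc a b)ᶜ = 0) : AnalyticOnNhd ℝ (charFun μ) univ := by
  have hae : ∀ᵐ s ∂μ, s ∈ Icc a b := mem_ae_iff.2 hμ
  have hset : integrableExpSet id μ = univ := by
    refine eq_univ_of_forall fun t => ?_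
    refine (integrable_const (Real.exp (|t| * max |a| |b|))).mono' (by fun_prop) ?_
    filter_upwards [hae] with s hs
    rw [Real.norm_of_nonneg (Real.exp_pos _).le, Real.exp_le_exp]
    refine (le_abs_self _).trans ?_
    rw [abs_mul]
    exact mul_le_mul_of_nonneg_left (abs_le_max_abs_abs hs.1 hs.2) (abs_nonneg t)
  intro t _
  have h1 : AnalyticAt ℝ (complexMGF id μ) ((t : ℂ) * I) :=
    (analyticAt_complexMGF (by rw [hset, interior_univ]; trivial)).restrictScalars
  have h2 : AnalyticAt ℝ (fun t : ℝ => (t : ℂ) * I) t :=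
    (ofRealCLM.analyticAt t).mul analyticAt_const
  refine (AnalyticAt.comp (f := fun t : ℝ => (t : ℂ) * I) h1 h2).congr (Eventually.of_forall fun t => ?_)
  exact complexMGF_id_mul_I t

/-- If the spectral measure has an accumulation point in its support, the potential determines a
compactly supported measure. -/
lemma IsSpectralMeasure.eq_of_potential_eq (hS : IsSpectralMeasure X P F)
    (hacc : ∃ x : ℝ, AccPt x (𝓟 F.support)) {a b : ℝ} {μ μ' : Measure ℝ} [IsFiniteMeasure μ]
    [IsFiniteMeasure μ'] (hμ : μ (Icc a b)ᶜ = 0) (hμ' : μ' (Icc a b)ᶜ = 0)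
    (h : ∀ t, potential (covFun X P) μ t = potential (covFun X P) μ' t) : μ = μ' := by
  set d : ℝ → ℂ := fun x => charFun μ x - charFun μ' x with hd
  have hcd : Continuous d := continuous_charFun.sub continuous_charFun
  have hbd (ν : Measure ℝ) [IsFiniteMeasure ν] (x : ℝ) : ‖charFun ν x‖ ≤ ν.real univ :=
    norm_charFun_le x
  have hdB (x : ℝ) : ‖d x‖ ≤ μ.real univ + μ'.real univ :=
    (norm_sub_le _ _).trans (add_le_add (hbd μ x) (hbd μ' x))
  have hnormexp (t x : ℝ) : ‖cexp (((t : ℂ) * I) * x)‖ = 1 := by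
    have : ((t : ℂ) * I) * x = ((t * x : ℝ) : ℂ) * I := by push_cast; ring
    rw [this, norm_exp_ofReal_mul_I]
  have hmeasc (ν : Measure ℝ) [IsFiniteMeasure ν] : Measurable (charFun ν) :=
    continuous_charFun.measurable
  have hint (ν : Measure ℝ) [IsFiniteMeasure ν] (t : ℝ) :
      Integrable (fun x : ℝ => cexp (((t : ℂ) * I) * x) * charFun ν (-x)) F := by
    refine (integrable_const (ν.real univ)).mono'
      (Measurable.aestronglyMeasurable (by have := hmeasc ν; fun_prop)) (ae_of_all _ fun x => ?_)
    rw [norm_mul, hnormexp, one_mul]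
    exact hbd ν _
  have hzero (t : ℝ) : ∫ x : ℝ, cexp (((t : ℂ) * I) * x) * d (-x) ∂F = 0 := by
    simp_rw [hd, mul_sub]
    rw [integral_sub (hint μ t) (hint μ' t), ← potential_eq_integral_charFun hS,
      ← potential_eq_integral_charFun hS, h, sub_self]
  -- Integrating the vanishing transform in `t` against `ν` replaces the exponential by `charFun ν`.
  -- Subtracting the cases `ν = μ` and `ν = μ'` gives `∫ |d|² dF = 0`, since `d (-x)` is the
  -- conjugate of `d x`.
  have hzero' (ν : Measure ℝ) [IsFiniteMeasure ν] : ∫ x : ℝ, charFun ν x * d (-x) ∂F = 0 := by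
    have h1 : ∫ t, ∫ x : ℝ, cexp (((t : ℂ) * I) * x) * d (-x) ∂F ∂ν = 0 := by simp [hzero]
    rw [integral_integral_swap] at h1
    · rw [← h1]
      congr 1 with x
      rw [integral_mul_const, charFun_apply_real]
      congr 2 with t
      congr 1
      ring
    · refine (integrable_const (μ.real univ + μ'.real univ)).mono'
        (Measurable.aestronglyMeasurable (by have := hcd.measurable; fun_prop))
        (ae_of_all _ fun p => ?_)
      rw [Function.uncurry, norm_mul, hnormexp, one_mul]
      exact hdB _
  have hconj (x : ℝ) : d (-x) = (starRingEnd ℂ) (d x) := by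
    simp only [hd, charFun_neg, map_sub]
  have hint' (ν : Measure ℝ) [IsFiniteMeasure ν] :
      Integrable (fun x : ℝ => charFun ν x * d (-x)) F := by
    refine (integrable_const (ν.real univ * (μ.real univ + μ'.real univ))).mono'
      (Measurable.aestronglyMeasurable (by have := hmeasc ν; have := hcd.measurable; fun_prop))
      (ae_of_all _ fun x => ?_)
    rw [norm_mul]
    exact mul_le_mul (hbd ν _) (hdB _) (norm_nonneg _) measureReal_nonneg
  have hnormSq : ∫ x, normSq (d x) ∂F = 0 := by
    have h1 : ∫ x : ℝ, (charFun μ x * d (-x) - charFun μ' x * d (-x)) ∂F = 0 := by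
      rw [integral_sub (hint' μ) (hint' μ'), hzero', hzero', sub_self]
    have h2 (x : ℝ) : charFun μ x * d (-x) - charFun μ' x * d (-x) = ((normSq (d x) : ℝ) : ℂ) := by
      rw [← sub_mul, hconj]
      exact mul_conj (d x)
    simp_rw [h2] at h1
    rwa [integral_complex_ofReal, ofReal_eq_zero] at h1
  have hintS : Integrable (fun x => normSq (d x)) F := by
    refine (integrable_const ((μ.real univ + μ'.real univ) ^ 2)).mono'
      (continuous_normSq.comp hcd).aestronglyMeasurable (ae_of_all _ fun x => ?_)
    rw [Real.norm_of_nonneg (normSq_nonneg _), normSq_eq_norm_sq]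
    exact pow_le_pow_left₀ (norm_nonneg _) (hdB x) 2
  have hae : ∀ᵐ x ∂F, d x = 0 := by
    filter_upwards [(integral_eq_zero_iff_of_nonneg (fun x => normSq_nonneg _) hintS).1 hnormSq]
      with x hx
    simpa using hx
  have hsupp : F.support ⊆ {x | d x = 0} :=
    Measure.support_subset_of_isClosed (isClosed_eq hcd continuous_const) hae
  obtain ⟨x₀, hx₀⟩ := hacc
  have hfreq : ∃ᶠ x in 𝓝[≠] x₀, charFun μ x = charFun μ' x := by
    rw [frequently_nhdsWithin_iff]
    exact (accPt_iff_frequently.1 hx₀).mono fun x hx => ⟨sub_eq_zero.1 (hsupp hx.2), hx.1⟩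
  exact Measure.ext_of_charFun
    ((analyticOnNhd_charFun_of_compl_Icc μ hμ).eq_of_frequently_eq
      (analyticOnNhd_charFun_of_compl_Icc μ' hμ') hfreq)

end Spectral

/-! ### Two-valued functions and the identity theorem -/

section Calculus

/-- Where `f` is differentiable it is continuous, hence locally constant; elsewhere `deriv` is 0 by
convention. Thus jumps between 1 and 0 do no harm. -/
lemma deriv_eq_zero_of_mem_pair {f : ℝ → ℝ} (hf : ∀ t, f t = 1 ∨ f t = 0) : deriv f = 0 := by
  funext t
  by_cases hd : DifferentiableAt ℝ f t
  · have h1 : ∀ᶠ x in 𝓝 t, f x ∈ Metric.ball (f t) (1 / 2) :=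
      hd.continuousAt.eventually_mem (Metric.ball_mem_nhds _ (by norm_num))
    have h2 : f =ᶠ[𝓝 t] fun _ => f t := by
      filter_upwards [h1] with x hx
      rw [Metric.mem_ball, Real.dist_eq] at hx
      rcases hf x with h | h <;> rcases hf t with h' | h' <;> rw [h, h'] at hx ⊢ <;> norm_num at hx
    simp [h2.deriv_eq]
  · exact deriv_zero_of_not_differentiableAt hd

lemma iteratedDeriv_two_eq_zero_of_mem_pair {f : ℝ → ℝ} (hf : ∀ t, f t = 1 ∨ f t = 0) (t : ℝ) :
    iteratedDeriv 2 f t = 0 := by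
  rw [iteratedDeriv_succ, iteratedDeriv_one, deriv_eq_zero_of_mem_pair hf]
  simp

lemma eq_const_of_infinite_of_analyticOnNhd {f : ℝ → ℝ} (hf : AnalyticOnNhd ℝ f univ) {S : Set ℝ}
    {a b V : ℝ} (hS : S ⊆ Icc a b) (hinf : S.Infinite) (h : ∀ t ∈ S, f t = V) (t : ℝ) :
    f t = V := by
  obtain ⟨x, -, hx⟩ := hinf.exists_accPt_of_subset_isCompact isCompact_Icc hS
  have hfreq : ∃ᶠ y in 𝓝[≠] x, f y = (fun _ => V) y := by
    rw [frequently_nhdsWithin_iff]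
    exact (accPt_iff_frequently.1 hx).mono fun y hy => ⟨h y hy.2, hy.1⟩
  exact congrFun (hf.eq_of_frequently_eq analyticOnNhd_const hfreq) t

end Calculus

/-! ### Covariances from linear regression -/

section Regression

variable {Ω : Type*} {m mΩ : MeasurableSpace Ω} {X : ℝ → Ω → ℝ} {P : Measure Ω}

lemma covFun_eq_of_condExp [IsProbabilityMeasure P] (hX : IsCenteredGaussian X P) (hm : m ≤ mΩ)
    {s t : ℝ} (hs : Measurable[m] (X s)) {c : ℝ →₀ ℝ}
    (hc : P[X t | m] =ᵐ[P] fun ω => c.sum fun r y => y * X r ω) :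
    covFun X P s t = c.sum fun r y => y * covFun X P s r := by
  have hint (r : ℝ) : Integrable (fun ω => X s ω * X r ω) P :=
    (memLp_two hX s).integrable_mul (memLp_two hX r)
  have h1 := condExp_mul_of_stronglyMeasurable_left (μ := P) hs.stronglyMeasurable (hint t)
    ((memLp_two hX t).integrable one_le_two)
  have h2 : covFun X P s t = ∫ ω, (P[X s * X t | m]) ω ∂P := (integral_condExp hm).symm
  rw [h2, integral_congr_ae h1, Finsupp.sum]
  simp only [covFun]
  simp_rw [← integral_const_mul]
  rw [← integral_finsetSum _ fun r _ => (hint r).const_mul _]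
  refine integral_congr_ae ?_
  filter_upwards [hc] with ω hω
  rw [Pi.mul_apply, hω, Finsupp.sum, Finset.mul_sum]
  exact Finset.sum_congr rfl fun r _ => by ring

lemma IsLinearRegression.covFun_eq [IsProbabilityMeasure P] (hX : IsCenteredGaussian X P)
    {S : Set ℝ} {t : ℝ} {c : ℝ →₀ ℝ} (hc : IsLinearRegression X P S t c) {s : ℝ} (hs : s ∈ S) :
    covFun X P s t = c.sum fun r y => y * covFun X P s r :=
  covFun_eq_of_condExp hX (iSup₂_le fun r _ => (hX.measurable r).comap_le)
    ((comap_measurable (X s)).mono (le_iSup₂_of_le s hs le_rfl) le_rfl) hc.2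

end Regression

/-! ### Finiteness of the support -/

section Support

variable {Ω : Type*} [MeasurableSpace Ω] {X : ℝ → Ω → ℝ} {P : Measure Ω} [IsProbabilityMeasure P]
  {a b : ℝ} (hab : a < b)

include hab

lemma integrable_covFun (hX : IsCenteredGaussian X P) {μ : Measure ℝ} (hμ : IsProbOn a b μ)
    (t : ℝ) : Integrable (fun s => covFun X P s t) μ := by
  obtain ⟨ν, hν, rfl⟩ := hμ.exists_map
  refine ((MeasurableEmbedding.subtype_coe measurableSet_Icc).integrable_map_iff).2 ?_
  have hi := integrable_smul_pathMap hX hab t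
  refine (integrable_continuousMap ν (∫ ω, X t ω • pathMap hX a b ω ∂P)).congr
    (ae_of_all _ fun x => ?_)
  have := (ContinuousMap.evalCLM ℝ x).integral_comp_comm hi
  simp only [Function.comp]
  rw [covFun_comm, covFun]
  simpa using this.symm

/-- The regression identity for covariances holds for `s` in the support, which has full measure, so
it can be integrated. -/
lemma IsLinearRegression.potential_eq (hX : IsCenteredGaussian X P) {μ : Measure ℝ}
    (hμ : IsProbOn a b μ) {t : ℝ} {c : ℝ →₀ ℝ} (hc : IsLinearRegression X P μ.support t c) :
    potential (covFun X P) μ t = c.sum fun r y => y * potential (covFun X P) μ r := by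
  simp only [potential, Finsupp.sum]
  simp_rw [← integral_const_mul]
  rw [← integral_finsetSum _ fun r _ => (integrable_covFun hab hX hμ r).const_mul _]
  refine integral_congr_ae ?_
  filter_upwards [Measure.support_mem_ae (μ := μ)] with s hs
  exact hc.covFun_eq hX hs

/-- If the potential of `μ` is constant and positive, the regression weights sum to one whenever
they exist. -/
lemma condMeanOne_eq_one_or_zero (hX : IsCenteredGaussian X P) {μ : Measure ℝ}
    (hμ : IsProbOn a b μ) {V : ℝ} (hV : 0 < V) (h : ∀ t, potential (covFun X P) μ t = V) (t : ℝ) :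
    condMeanOne X P μ.support t = 1 ∨ condMeanOne X P μ.support t = 0 := by
  rw [condMeanOne]
  split_ifs with hex
  · left
    have h1 := hex.choose_spec.potential_eq hab hX hμ
    simp_rw [h, Finsupp.sum, ← Finset.sum_mul] at h1
    exact (mul_right_cancel₀ hV.ne' ((one_mul V).trans h1)).symm
  · exact Or.inr rfl

/-- A minimizer with analytic potential, positive energy and strictly convex conditional mean
on its support is finitely supported. -/
lemma IsMinimizer.finite_support (hX : IsCenteredGaussian X P) {μ : Measure ℝ}
    (hμ : IsMinimizer (covFun X P) a b μ) (hpos : 0 < energy (covFun X P) μ)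
    (han : AnalyticOnNhd ℝ (potential (covFun X P) μ) univ)
    (hconv : ∀ t ∈ μ.support ∩ Ioo a b, 0 < iteratedDeriv 2 (condMeanOne X P μ.support) t) :
    μ.support.Finite := by
  by_contra hinf
  have hconst := eq_const_of_infinite_of_analyticOnNhd han hμ.support_subset hinf
    fun t ht => hμ.potential_eq hab hX ht
  -- An infinite support contains a point other than the endpoints, where the convexity hypothesis
  -- applies.
  obtain ⟨t, ht, htne⟩ := (Set.Infinite.sdiff hinf (toFinite {a, b})).nonempty
  have hmem := hμ.support_subset ht
  simp only [mem_insert_iff, mem_singleton_iff, not_or] at htne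
  have := hconv t ⟨ht, lt_of_le_of_ne hmem.1 (Ne.symm htne.1), lt_of_le_of_ne hmem.2 htne.2⟩
  rw [iteratedDeriv_two_eq_zero_of_mem_pair
    (condMeanOne_eq_one_or_zero hab hX hμ.probOn hpos hconst)] at this
  exact lt_irrefl _ this

end Support

/-! ### Finitely supported measures -/

section FiniteSupport

lemma integral_eq_sum_of_compl_null {μ : Measure ℝ} [IsFiniteMeasure μ] {I : Finset ℝ}
    (hI : μ (I : Set ℝ)ᶜ = 0) (f : ℝ → ℝ) : ∫ s, f s ∂μ = ∑ s ∈ I, μ.real {s} * f s := by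
  have h1 : μ.restrict (I : Set ℝ) = μ := Measure.restrict_eq_self_of_ae_mem (mem_ae_iff.2 hI)
  rw [← h1, setIntegral_finset I IntegrableOn.finset, h1]
  simp

lemma measure_ext_of_compl_null {μ μ' : Measure ℝ} [IsFiniteMeasure μ] [IsFiniteMeasure μ']
    {I : Finset ℝ} (hI : μ (I : Set ℝ)ᶜ = 0) (hI' : μ' (I : Set ℝ)ᶜ = 0)
    (h : ∀ s ∈ I, μ.real {s} = μ'.real {s}) : μ = μ' := by
  refine Measure.ext fun A hA => ?_
  rw [← measureReal_eq_measureReal_iff, ← integral_indicator_one hA, ← integral_indicator_one hA,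
    integral_eq_sum_of_compl_null hI, integral_eq_sum_of_compl_null hI']
  exact Finset.sum_congr rfl fun s hs => by rw [h s hs]

lemma compl_null_of_support_subset {μ : Measure ℝ} {I : Set ℝ} (h : μ.support ⊆ I) : μ Iᶜ = 0 :=
  measure_mono_null (compl_subset_compl.2 h) Measure.measure_compl_support

variable {Ω : Type*} [MeasurableSpace Ω] {X : ℝ → Ω → ℝ} {P : Measure Ω} [IsProbabilityMeasure P]

/-- Finitely supported measures are determined by their potential if the finite dimensional
covariance matrices are non-singular. -/
lemma SmoothNonsingular.eq_of_potential_eq (hX : IsCenteredGaussian X P)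
    (hns : SmoothNonsingular X P) {μ μ' : Measure ℝ} [IsFiniteMeasure μ] [IsFiniteMeasure μ']
    {I : Finset ℝ} (hI : μ (I : Set ℝ)ᶜ = 0) (hI' : μ' (I : Set ℝ)ᶜ = 0)
    (h : ∀ t, potential (covFun X P) μ t = potential (covFun X P) μ' t) : μ = μ' := by
  refine measure_ext_of_compl_null hI hI' fun s hs => ?_
  let J : Finset (ℝ × ℕ) := I.map ⟨fun s => (s, 0), fun x y hxy => congrArg Prod.fst hxy⟩
  have hJ (p : ℝ × ℕ) (hp : p ∈ J) : p.2 = 0 ∧ p.1 ∈ I := by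
    obtain ⟨x, hx, rfl⟩ := Finset.mem_map.1 hp
    exact ⟨rfl, hx⟩
  let v : J → ℝ := fun p => μ.real {p.1.1} - μ'.real {p.1.1}
  have hpd (p : J) : pathDeriv X p.1.2 p.1.1 = X p.1.1 := by
    funext ω
    rw [pathDeriv, (hJ _ p.2).1, iteratedDeriv_zero]
  -- Equality of the potentials at the points of `I` says that the difference of masses lies in the
  -- kernel of the covariance matrix of `(X_s : s ∈ I)`, all derivative orders in `J` being 0.
  have hv := Matrix.eq_zero_of_mulVec_eq_zero (hns.nonsingular J) (v := v) (by
    funext p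
    have h2 := h p.1.1
    rw [potential, potential, integral_eq_sum_of_compl_null hI,
      integral_eq_sum_of_compl_null hI', ← sub_eq_zero, ← Finset.sum_sub_distrib] at h2
    simp only [Matrix.mulVec, dotProduct, Matrix.of_apply, hpd, Pi.zero_apply]
    rw [← h2]
    have h3 : ∑ x ∈ I, (μ.real {x} * covFun X P x p.1.1 - μ'.real {x} * covFun X P x p.1.1) =
        ∑ q ∈ J, (μ.real {q.1} * covFun X P q.1 p.1.1 - μ'.real {q.1} * covFun X P q.1 p.1.1) := by
      rw [Finset.sum_map]
      rfl
    rw [h3, ← Finset.sum_coe_sort J]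
    refine Finset.sum_congr rfl fun q _ => ?_
    rw [covariance_eq_sub (memLp_two hX _) (memLp_two hX _), hX.centered, zero_mul, sub_zero,
      covFun_comm, covFun]
    simp only [v, Pi.mul_apply]
    ring)
  have hsJ : ((s, 0) : ℝ × ℕ) ∈ J := Finset.mem_map.2 ⟨s, hs, rfl⟩
  exact sub_eq_zero.1 (congrFun hv ⟨(s, 0), hsJ⟩)

/-- The potential is a finite convex combination of the functions `R s`, each eventually at most `V
/ 2`. -/
lemma eventually_potential_lt {a b : ℝ} {R : ℝ → ℝ → ℝ}
    (hR : ∀ s ∈ Icc a b, limsup (fun t => ((R s t : ℝ) : EReal)) atTop ≤ 0)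
    {μ : Measure ℝ} [IsProbabilityMeasure μ] {I : Finset ℝ} (hIab : (I : Set ℝ) ⊆ Icc a b)
    (hI : μ (I : Set ℝ)ᶜ = 0) {V : ℝ} (hV : 0 < V) :
    ∀ᶠ t in atTop, potential R μ t < V := by
  have h1 : ∀ᶠ t in atTop, ∀ s ∈ I, R s t ≤ V / 2 := by
    refine (Finset.eventually_all I).2 fun s hs => ?_
    have h2 : limsup (fun t => ((R s t : ℝ) : EReal)) atTop < ((V / 2 : ℝ) : EReal) :=
      (hR s (hIab hs)).trans_lt (by exact_mod_cast half_pos hV)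
    filter_upwards [eventually_lt_of_limsup_lt h2] with t ht
    exact (EReal.coe_lt_coe_iff.1 ht).le
  have h3 : ∑ s ∈ I, μ.real {s} = 1 := by
    have := integral_eq_sum_of_compl_null hI (fun _ => 1)
    simpa using this.symm
  filter_upwards [h1] with t ht
  rw [potential, integral_eq_sum_of_compl_null hI]
  calc ∑ s ∈ I, μ.real {s} * R s t ≤ ∑ s ∈ I, μ.real {s} * (V / 2) :=
        Finset.sum_le_sum fun s hs => mul_le_mul_of_nonneg_left (ht s hs) measureReal_nonneg
    _ = V / 2 := by rw [← Finset.sum_mul, h3, one_mul]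
    _ < V := half_lt_self hV

end FiniteSupport

/-! ### Positivity and uniqueness under each set of assumptions -/

section Assumptions

variable {Ω : Type*} [MeasurableSpace Ω] {X : ℝ → Ω → ℝ} {P : Measure Ω} [IsProbabilityMeasure P]
  {a b : ℝ} (hab : a < b)

include hab

/-- Convexity is not available for `μ'`. If its support were infinite, its potential would be
constant and equal to its positive energy; but it is also the potential of the finitely supported
`μ`, which eventually drops below that energy. -/
lemma AssumptionA.eq_of_isMinimizer (hA : AssumptionA X P a b) (hX : IsCenteredGaussian X P)
    {μ μ' : Measure ℝ} (hμ : IsMinimizer (covFun X P) a b μ)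
    (hμ' : IsMinimizer (covFun X P) a b μ') (hfin : μ.support.Finite) : μ' = μ := by
  have := hμ.probOn.prob
  have := hμ'.probOn.prob
  have hpos := hA.nondegenerate a b hab.le μ' hμ'.probOn
  have hfin' : μ'.support.Finite := by
    by_contra hinf
    have hconst := eq_const_of_infinite_of_analyticOnNhd
      (hA.power.analyticOnNhd_potential hμ'.probOn) hμ'.support_subset hinf
      fun t ht => hμ'.potential_eq hab hX ht
    obtain ⟨t, ht⟩ := (eventually_potential_lt hA.limsup_le (μ := μ) (I := hfin.toFinset)
      (by simpa using hμ.support_subset)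
      (compl_null_of_support_subset (by simp)) hpos).exists
    rw [hμ.potential_congr hab hX hμ', hconst] at ht
    exact lt_irrefl _ ht
  classical
  exact hA.smooth.eq_of_potential_eq hX (I := hfin.toFinset ∪ hfin'.toFinset)
    (compl_null_of_support_subset (by simp)) (compl_null_of_support_subset (by simp))
    (hμ'.potential_congr hab hX hμ)

/-- Zero energy would make the potential vanish identically, and the spectral uniqueness result
would identify `μ` with the zero measure. -/
lemma AssumptionB.energy_pos (hB : AssumptionB X P) (hX : IsCenteredGaussian X P) {μ : Measure ℝ}
    (hμ : IsProbOn a b μ) : 0 < energy (covFun X P) μ := by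
  obtain ⟨F, hF, -, hacc⟩ := hB.spectral
  have := hF.finite
  have := hμ.prob
  refine (energy_nonneg hab hX hμ).lt_of_ne fun h0 => ?_
  have h1 : μ = 0 := hF.eq_of_potential_eq (μ' := 0) hacc hμ.compl_null (by simp) fun t => by
    rw [potential_eq_zero_of_energy_eq_zero hab hX hμ h0.symm t, potential, integral_zero_measure]
  exact IsProbabilityMeasure.ne_zero μ h1

lemma AssumptionB.eq_of_isMinimizer (hB : AssumptionB X P) (hX : IsCenteredGaussian X P)
    {μ μ' : Measure ℝ} (hμ : IsMinimizer (covFun X P) a b μ)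
    (hμ' : IsMinimizer (covFun X P) a b μ') : μ' = μ := by
  obtain ⟨F, hF, -, hacc⟩ := hB.spectral
  have := hF.finite
  have := hμ.probOn.prob
  have := hμ'.probOn.prob
  exact hF.eq_of_potential_eq hacc hμ'.probOn.compl_null hμ.probOn.compl_null
    (hμ'.potential_congr hab hX hμ)

omit [IsProbabilityMeasure P] hab in
lemma AssumptionB.analyticOnNhd_potential (hB : AssumptionB X P) {μ : Measure ℝ}
    (hμ : IsProbOn a b μ) : AnalyticOnNhd ℝ (potential (covFun X P) μ) univ := by
  obtain ⟨F, hF, hexp, -⟩ := hB.spectral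
  have := hF.finite
  have := hμ.prob
  exact hF.analyticOnNhd_potential hexp μ

end Assumptions

end GaussMin

end

theorem theorem4p3 {Ω : Type*} [MeasurableSpace Ω] (P : Measure Ω) [IsProbabilityMeasure P]
    (X : ℝ → Ω → ℝ) (hX : GaussMin.IsCenteredGaussian X P) (a b : ℝ) (hab : a < b)
    (hassume : GaussMin.AssumptionA X P a b ∨ GaussMin.AssumptionB X P) :
    -- the minimization problem has a solution
    (∃ ν : Measure ℝ, GaussMin.IsMinimizer (GaussMin.covFun X P) a b ν) ∧
    ∀ ν : Measure ℝ, GaussMin.IsMinimizer (GaussMin.covFun X P) a b ν →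
      -- `μ'' > 0` on `S ∩ (a,b)`, where `S` is the support of the minimizer
      (∀ t ∈ ν.support ∩ Ioo a b,
        0 < iteratedDeriv 2 (GaussMin.condMeanOne X P ν.support) t) →
      -- the minimizer is unique and has finite support, and all quantities below make sense
      (∀ ν' : Measure ℝ, GaussMin.IsMinimizer (GaussMin.covFun X P) a b ν' → ν' = ν) ∧
      ν.support.Finite ∧
      0 < GaussMin.optimalValue (GaussMin.covFun X P) a b ∧
      (∀ u : ℝ, 0 < P (GaussMin.highEvent X a b u)) ∧
      -- the conditional law of the scaled overshoot converges to the exponential law of mean `V_*`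
      GaussMin.WeaklyConverges (GaussMin.overshootLaw X P a b)
        (expMeasure (GaussMin.optimalValue (GaussMin.covFun X P) a b)⁻¹) := by
  refine ⟨GaussMin.exists_isMinimizer hab hX, fun ν hν hconv => ?_⟩
  have hpos : 0 < GaussMin.energy (GaussMin.covFun X P) ν := by
    rcases hassume with hA | hB
    · exact hA.nondegenerate a b hab.le ν hν.probOn
    · exact hB.energy_pos hab hX hν.probOn
  have hfin : ν.support.Finite := by
    refine hν.finite_support hab hX hpos ?_ hconv
    rcases hassume with hA | hB
    · exact hA.power.analyticOnNhd_potential hν.probOn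
    · exact hB.analyticOnNhd_potential hν.probOn
  rw [hν.optimalValue_eq]
  refine ⟨fun ν' hν' => ?_, hfin, hpos, hν.overshoot hab hX hpos⟩
  rcases hassume with hA | hB
  · exact hA.eq_of_isMinimizer hab hX hν hν' hfin
  · exact hB.eq_of_isMinimizer hab hX hν hν'
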